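/- Let $S$ be a smooth surface and let $D=\{c_1,\dots,c_n\}$ be an (ordered) star divisor on $S$, that is, a finite family of smooth closed curves in $S$ (closed subsets that are embedded one-dimensional submanifolds) which are pairwise transverse. The sections of the $b$-tangent bundle ${}^bTS$ of $(S,D)$ are the smooth vector fields tangent to every curve of $D$. A star log symplectic form is a smooth section $\omega$ of $\wedge^2({}^bT^*S)$ (a smooth $2$-form on $S\setminus D$ whose values on pairs of local $b$-vector fields extend smoothly over $D$) that is nondegenerate on ${}^bTS$ at every point of $S$; such a form is automatically closed. Let $p\in S$ be a point of degree $k\ge 2$, i.e. a point lying on exactly $k$ of the curves; renumber those curves $c_1,\dots,c_k$, keeping their order. Let $(U_0,(x,y))$ be any star chart centered at $p$: a smooth chart with $p=(0,0)$ in which $c_1=\{x=0\}$, $c_2=\{y=0\}$ and $c_i=\{A_ix+B_iy=0\}$ for $3\le i\le k$, with $A_i,B_i\in\mathbb{R}$. Then there are an open neighborhood $U\subseteq U_0$ of $p$, real numbers $c\neq 0$ and $\lambda_i,\delta_i$ $(3\le i\le k)$, $\nu_{ij}$ $(3\le i<j\le k)$, and a $b$-symplectomorphism $\Psi$ from $U$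 onto an open neighborhood of $p$ in $S$ (a diffeomorphism onto its image with $\Psi(p)=p$ that maps each curve of $D$ to itself, i.e. $q\in c_i\iff\Psi(q)\in c_i$ for $q\in U$) such that on $U$ $$\Psi^*\omega=\Big(\frac{c}{xy\prod_{i=3}^k(A_ix+B_iy)}+P\Big)\,dx\wedge dy,$$ $$P=\sum_{i=3}^k\Big(\frac{\lambda_i}{x(A_ix+B_iy)}+\frac{\delta_i}{y(A_ix+B_iy)}\Big)+\sum_{3\le i<j\le k}\frac{\nu_{ij}}{(A_ix+B_iy)(A_jx+B_jy)}.$$ Moreover, if $k\ge 3$ one can take $c\in\{1,-1\}$, and $c=1$ if in addition $k$ is odd. (For even $k\ge 4$ the sign can be absorbed by replacing one pair $(A_i,B_i)$ by $(-A_i,-B_i)$. For $k=2$ one has $P=0$.) -/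

import Mathlib

open scoped Manifold ContDiff

noncomputable section

namespace StarLog

/-- The model plane `ℝ²` with coordinates `x = v 0` and `y = v 1`. -/
abbrev Plane : Type := EuclideanSpace ℝ (Fin 2)

/-- The exterior product `a ∧ b` of two covectors:
`(a ∧ b)(v, w) = a(v) b(w) - a(w) b(v)`. -/
def wedge {V : Type*} [AddCommGroup V] [Module ℝ V] [TopologicalSpace V]
    (a b : V →L[ℝ] ℝ) : V [⋀^Fin 2]→L[ℝ] ℝ where
  toFun v := a (v 0) * b (v 1) - a (v 1) * b (v 0)
  map_update_add' := by
    intro inst v i x y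
    rw [Subsingleton.elim inst (instDecidableEqFin 2)]
    fin_cases i <;> simp <;> ring
  map_update_smul' := by
    intro inst v i c x
    rw [Subsingleton.elim inst (instDecidableEqFin 2)]
    fin_cases i <;> simp <;> ring
  map_eq_zero_of_eq' := by
    intro v i j h hij
    fin_cases i <;> fin_cases j <;> simp_all
  cont := by fun_prop

section Surface

variable {S : Type*} [TopologicalSpace S] [ChartedSpace Plane S]

/-- On the open set `U`, the smooth function `f` is a defining function of `c`: inside `U` the set
`c` is the zero set of `f`, and `df ≠ 0` along `c`. -/
structure IsDefiningFunctionOn (c U : Set S) (f : S → ℝ) : Prop where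
  isOpen : IsOpen U
  contMDiffOn : ContMDiffOn (𝓡 2) 𝓘(ℝ, ℝ) ∞ f U
  mem_iff : ∀ q ∈ U, q ∈ c ↔ f q = 0
  mfderiv_ne_zero : ∀ q ∈ U, q ∈ c → mfderiv (𝓡 2) 𝓘(ℝ, ℝ) f q ≠ 0

/-- A smooth closed curve in the surface `S`: a closed subset that is an embedded smooth
one-dimensional submanifold, i.e. locally has a defining function. -/
def IsSmoothClosedCurve (c : Set S) : Prop :=
  IsClosed c ∧ ∀ q ∈ c, ∃ (U : Set S) (f : S → ℝ), q ∈ U ∧ IsDefiningFunctionOn c U f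

/-- The tangent line `T_q c ⊆ T_q S` of a smooth curve `c` at a point `q ∈ c`: the kernel of the
differential of a local defining function (all of them have the same kernel). -/
def tangentLine (c : Set S) (q : S) : Submodule ℝ (TangentSpace (𝓡 2) q) where
  carrier := {v | ∀ (U : Set S) (f : S → ℝ), q ∈ U → IsDefiningFunctionOn c U f →
    mfderiv (𝓡 2) 𝓘(ℝ, ℝ) f q v = 0}
  zero_mem' := fun U f _ _ => map_zero _
  add_mem' := fun hv hw U f hq hf => by rw [map_add, hv U f hq hf, hw U f hq hf, add_zero]
  smul_mem' := fun r v hv U f hq hf => by rw [map_smul, hv U f hq hf, smul_zero]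

variable (S) in
/-- An (ordered) star divisor on `S`: a finite family of smooth closed curves which are pairwise
transverse. -/
structure StarDivisor (n : ℕ) where
  curve : Fin n → Set S
  isCurve : ∀ i, IsSmoothClosedCurve (curve i)
  transverse : ∀ i j, i ≠ j → ∀ q, q ∈ curve i → q ∈ curve j →
    tangentLine (curve i) q ⊔ tangentLine (curve j) q = ⊤

variable {n : ℕ}

/-- The union of the curves of the divisor. -/
def StarDivisor.support (D : StarDivisor S n) : Set S := ⋃ i, D.curve i

/-- The degree of a point: the number of curves of `D` that contain it. -/
def StarDivisor.degree (D : StarDivisor S n) (p : S) : ℕ := Set.ncard {i | p ∈ D.curve i}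

/-- A star chart centered at the intersection point `p`: a smooth chart `(U, (x, y))` in which the
two curves `α < β` of smallest index through `p` are `{x = 0}` and `{y = 0}`, and every curve
`ℓ` through `p` is a line `{A ℓ * x + B ℓ * y = 0}`. The coefficients are part of the data. -/
structure StarChart (D : StarDivisor S n) (p : S) where
  chart : OpenPartialHomeomorph S Plane
  mem_atlas : chart ∈ IsManifold.maximalAtlas (𝓡 2) ∞ S
  mem_source : p ∈ chart.source
  centered : chart p = 0
  α : Fin n
  β : Fin n
  α_mem : p ∈ D.curve α
  β_mem : p ∈ D.curve β
  α_lt_β : α < β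
  smallest : ∀ i, p ∈ D.curve i → i = α ∨ β ≤ i
  curve_α : ∀ q ∈ chart.source, q ∈ D.curve α ↔ chart q 0 = 0
  curve_β : ∀ q ∈ chart.source, q ∈ D.curve β ↔ chart q 1 = 0
  A : Fin n → ℝ
  B : Fin n → ℝ
  curve_line : ∀ i, p ∈ D.curve i → ∀ q ∈ chart.source,
    (q ∈ D.curve i ↔ A i * chart q 0 + B i * chart q 1 = 0)

/-- A `b`-vector field on the open set `U`: a smooth vector field on `U` which is tangent to every
curve of `D`. These are the sections over `U` of the `b`-tangent bundle of `(S, D)`. -/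
structure IsBVectorFieldOn [IsManifold (𝓡 2) ∞ S] (D : StarDivisor S n) (U : Set S)
    (X : ∀ q : S, TangentSpace (𝓡 2) q) : Prop where
  contMDiffOn : ContMDiffOn (𝓡 2) (𝓡 2).tangent ∞
    (fun q => (⟨q, X q⟩ : TangentBundle (𝓡 2) S)) U
  tangent : ∀ q ∈ U, ∀ i, q ∈ D.curve i → X q ∈ tangentLine (D.curve i) q

variable (S) in
/-- Pointwise alternating 2-forms on the tangent spaces of `S`, without any smoothness. Singular
forms along a divisor are such families whose values on the divisor are ignored. -/
abbrev TwoForm : Type _ := ∀ q : S, (TangentSpace (𝓡 2) q) [⋀^Fin 2]→L[ℝ] ℝ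

/-- The smooth function `g` on `U` is the value `Ω(X, Y)` of the `b`-form `Ω` on the `b`-fields
`X, Y`, i.e. it extends smoothly over the divisor the function `Ω(X, Y)`. -/
def IsPairingOn (D : StarDivisor S n) (Ω : TwoForm S) (U : Set S)
    (X Y : ∀ q : S, TangentSpace (𝓡 2) q) (g : S → ℝ) : Prop :=
  ContMDiffOn (𝓡 2) 𝓘(ℝ, ℝ) ∞ g U ∧ ∀ q ∈ U, q ∉ D.support → Ω q ![X q, Y q] = g q

/-- `Ω` is a smooth section of the second exterior power of the `b`-cotangent bundle: the pairing
of `Ω` with any two local `b`-vector fields is (extends over the divisor to) a smooth function.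
Away from the divisor every vector field is a `b`-field, so there this is ordinary smoothness; as
the complement of the divisor is dense, a `b`-form is determined by its values there. -/
def IsBTwoForm [IsManifold (𝓡 2) ∞ S] (D : StarDivisor S n) (Ω : TwoForm S) : Prop :=
  ∀ U : Set S, IsOpen U → ∀ X Y : (∀ q : S, TangentSpace (𝓡 2) q),
    IsBVectorFieldOn D U X → IsBVectorFieldOn D U Y → ∃ g : S → ℝ, IsPairingOn D Ω U X Y g

/-- A star log symplectic form: a `b`-form of degree two which is nondegenerate at every point of
`S` as a form on the `b`-tangent bundle, i.e. takes a nonzero value on some pair of `b`-vectors of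
that point. It is automatically closed, since the `b`-tangent bundle has rank two and so has no
nonzero 3-forms. -/
structure IsStarLogSymplectic [IsManifold (𝓡 2) ∞ S] (D : StarDivisor S n) (Ω : TwoForm S) :
    Prop where
  isBTwoForm : IsBTwoForm D Ω
  nondegenerate : ∀ q : S, ∃ (U : Set S) (X Y : ∀ q : S, TangentSpace (𝓡 2) q) (g : S → ℝ),
    IsOpen U ∧ q ∈ U ∧ IsBVectorFieldOn D U X ∧ IsBVectorFieldOn D U Y ∧
      IsPairingOn D Ω U X Y g ∧ g q ≠ 0

/-- `Ψ` is a `b`-symplectomorphism from `(U, Ω₀)` to `(Ψ(U), Ω)`, where `U = Ψ.source`: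
a diffeomorphism between open subsets of `S` that maps each curve of `D` to itself and satisfies
`Ψ^* Ω = Ω₀` (off the divisor, hence as `b`-forms). -/
structure IsBSymplectomorphism (D : StarDivisor S n) (Ω₀ Ω : TwoForm S)
    (Ψ : OpenPartialHomeomorph S S) : Prop where
  contMDiffOn : ContMDiffOn (𝓡 2) (𝓡 2) ∞ Ψ Ψ.source
  contMDiffOn_symm : ContMDiffOn (𝓡 2) (𝓡 2) ∞ Ψ.symm Ψ.target
  mem_curve_iff : ∀ i, ∀ q ∈ Ψ.source, Ψ q ∈ D.curve i ↔ q ∈ D.curve i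
  pullback_eq : ∀ q ∈ Ψ.source, q ∉ D.support →
    (Ω (Ψ q)).compContinuousLinearMap (mfderiv (𝓡 2) (𝓡 2) Ψ q) = Ω₀ q

namespace StarChart

variable {D : StarDivisor S n} {p : S}

/-- The coordinate function `x` of the star chart. -/
def x (χ : StarChart D p) (q : S) : ℝ := χ.chart q 0

/-- The coordinate function `y` of the star chart. -/
def y (χ : StarChart D p) (q : S) : ℝ := χ.chart q 1

/-- The linear function `A i * x + B i * y` defining the `i`-th curve through `p`. -/
def line (χ : StarChart D p) (i : Fin n) (q : S) : ℝ := χ.A i * χ.x q + χ.B i * χ.y q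

open Classical in
/-- The (indices of the) curves through `p` other than `{x = 0}` and `{y = 0}`. -/
def others (χ : StarChart D p) : Finset (Fin n) :=
  {i : Fin n | p ∈ D.curve i ∧ i ≠ χ.α ∧ i ≠ χ.β}

/-- The 2-form `dx ∧ dy` of the star chart. -/
def dxdy (χ : StarChart D p) : TwoForm S := fun q =>
  wedge (V := TangentSpace (𝓡 2) q)
    (mfderiv (𝓡 2) 𝓘(ℝ, ℝ) χ.x q) (mfderiv (𝓡 2) 𝓘(ℝ, ℝ) χ.y q)

/-- The function
`P = ∑ i, (lam i / (x L_i) + del i / (y L_i)) + ∑ i < j, nu i j / (L_i L_j)`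
with `L_i = A i * x + B i * y`, the indices running over the curves through `p` other than
`{x = 0}` and `{y = 0}`. -/
def polePart (χ : StarChart D p) (lam del : Fin n → ℝ) (nu : Fin n → Fin n → ℝ) (q : S) : ℝ :=
  ∑ i ∈ χ.others, (lam i / (χ.x q * χ.line i q) + del i / (χ.y q * χ.line i q))
    + ∑ i ∈ χ.others, ∑ j ∈ χ.others with i < j, nu i j / (χ.line i q * χ.line j q)

/-- The normal form `(c / (x y ∏ L_i) + P) dx ∧ dy`. -/
def normalForm (χ : StarChart D p) (c : ℝ) (lam del : Fin n → ℝ) (nu : Fin n → Fin n → ℝ) :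
    TwoForm S := fun q =>
  (c / (χ.x q * χ.y q * ∏ i ∈ χ.others, χ.line i q) + χ.polePart lam del nu q) • χ.dxdy q

end StarChart

end Surface

end StarLog

end

/- In the star chart write `Ω = (F / Q) dx ∧ dy`, where `Q` is the product of the `k` linear forms.
A radial map `Ψ z = ρ z • z` preserves every line through the origin; its Jacobian is `ρ (ρ + E ρ)`
for the Euler field `E`, and `Q (Ψ z) = ρ ^ k * Q z`. Hence, with `m = k - 2`, the pullback of `Ω`
is `((c + h) / Q) dx ∧ dy` if and only if `(ρ + E ρ) F (ρ z) = (c + h) ρ ^ (m + 1)`. The operator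
`E - m` maps smooth functions onto smooth functions modulo homogeneous polynomials `h` of degree
`m`, and a solution `A` of `(E - m) A = F - h` turns this equation into the level set equation of
`A (r z) / r ^ m + h z log r` in `r = ρ z`, which the implicit function theorem solves. The value
`ρ 0` is free and normalizes `c = F 0 / ρ 0 ^ m`. Partial fractions turn `h / Q` into the pole
part, even with all `ν = 0`. -/

namespace StarLog

section Analysis

open MeasureTheory Set Filter Topology

section ParametricIntegral

variable {E F : Type*} [NormedAddCommGroup E] [NormedSpace ℝ E] [FiniteDimensional ℝ E]
  [NormedAddCommGroup F] [NormedSpace ℝ F]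

theorem hasFDerivAt_integral_unitInterval {f : E × ℝ → F} (hf : ContDiff ℝ 1 f) (z : E) :
    HasFDerivAt (fun z => ∫ s in (0 : ℝ)..1, f (z, s))
      (∫ s in (0 : ℝ)..1, (fderiv ℝ f (z, s)).comp (.inl ℝ E ℝ)) z := by
  have hf' : Continuous fun q => (fderiv ℝ f q).comp (.inl ℝ E ℝ) :=
    (hf.continuous_fderiv one_ne_zero).clm_comp continuous_const
  have hsec (w : E) : Continuous fun s : ℝ => (w, s) := by fun_prop
  obtain ⟨C, hC⟩ := ((isCompact_closedBall z 1).prod (isCompact_Icc (a := (0 : ℝ)) (b := 1)))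
    |>.exists_bound_of_continuousOn hf'.continuousOn
  refine intervalIntegral.hasFDerivAt_integral_of_dominated_of_fderiv_le (𝕜 := ℝ)
    (F := fun z s => f (z, s)) (F' := fun z s => (fderiv ℝ f (z, s)).comp (.inl ℝ E ℝ))
    (bound := fun _ => C) (Metric.ball_mem_nhds z one_pos) ?_ ?_ ?_ ?_ intervalIntegrable_const ?_
  · exact .of_forall fun w => (hf.continuous.comp (hsec w)).aestronglyMeasurable
  · exact (hf.continuous.comp (hsec z)).intervalIntegrable _ _
  · exact (hf'.comp (hsec z)).aestronglyMeasurable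
  · refine .of_forall fun s hs w hw => hC (w, s) ⟨Metric.ball_subset_closedBall hw, ?_⟩
    rw [uIoc_of_le zero_le_one] at hs
    exact Ioc_subset_Icc_self hs
  · exact .of_forall fun s _ w _ =>
      (hf.differentiable one_ne_zero (w, s)).hasFDerivAt.comp (f := fun w : E => (w, s)) w
        (hasFDerivAt_prodMk_left w s)

theorem contDiff_integral_unitInterval {f : E × ℝ → F} (hf : ContDiff ℝ ∞ f) :
    ContDiff ℝ ∞ fun z => ∫ s in (0 : ℝ)..1, f (z, s) := by
  refine contDiff_infty.2 fun n => ?_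
  induction n generalizing f with
  | zero =>
    exact contDiff_zero.2 (continuous_iff_continuousAt.2 fun z =>
      (hasFDerivAt_integral_unitInterval (hf.of_le (by simp)) z).continuousAt)
  | succ n ih =>
    have hderiv := hasFDerivAt_integral_unitInterval (hf.of_le (by simp) : ContDiff ℝ 1 f)
    refine (contDiff_succ_iff_fderiv_apply (n := (n : ℕ∞ω))).2
      ⟨fun z => (hderiv z).differentiableAt, by simp, fun v => ?_⟩
    have hf' : ContDiff ℝ ∞ fun q => (fderiv ℝ f q).comp (.inl ℝ E ℝ) :=
      (hf.fderiv_right (m := ∞) (by simp)).clm_comp contDiff_const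
    have hv : ContDiff ℝ ∞ fun q => fderiv ℝ f q (v, 0) :=
      (hf.fderiv_right (m := ∞) (by simp)).clm_apply contDiff_const
    convert ih hv using 2 with z
    rw [(hderiv z).fderiv, ContinuousLinearMap.intervalIntegral_apply]
    · simp
    · exact (hf'.continuous.comp (by fun_prop : Continuous fun s : ℝ => (z, s))).intervalIntegrable
        _ _

end ParametricIntegral

section Segment

variable {E : Type*} [NormedAddCommGroup E] [NormedSpace ℝ E]

theorem map_add_eq_add_integral_fderiv {f : E → ℝ} (hf : ContDiff ℝ 1 f) (a v : E) :
    f (a + v) = f a + ∫ s in (0 : ℝ)..1, fderiv ℝ f (a + s • v) v := by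
  simpa using map_add_eq_sum_add_integral_iteratedFDeriv (n := 0) (f := f) (x := a) (y := v)
    fun t _ => by simpa using hf.contDiffAt

variable [FiniteDimensional ℝ E]

/-- The mean value `∫₀¹ G (s z) ds` of `G` over the segment from the origin to `z`: the smooth
solution `M` of `E M + M = G` for the Euler field `E`. -/
noncomputable def radialMean (G : E → ℝ) (z : E) : ℝ := ∫ s in (0 : ℝ)..1, G (s • z)

theorem contDiff_radialMean {G : E → ℝ} (hG : ContDiff ℝ ∞ G) : ContDiff ℝ ∞ (radialMean G) :=
  contDiff_integral_unitInterval (f := fun q : E × ℝ => G (q.2 • q.1))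
    (hG.comp (contDiff_snd.smul contDiff_fst))

theorem fderiv_radialMean_apply_self {G : E → ℝ} (hG : ContDiff ℝ ∞ G) (z : E) :
    fderiv ℝ (radialMean G) z z + radialMean G z = G z := by
  have hcont : Continuous fun s : ℝ => G (s • z) := hG.continuous.comp (by fun_prop)
  have hscale (r : ℝ) : ∫ s in (0 : ℝ)..r, G (s • z) = r * radialMean G (r • z) := by
    simpa [radialMean, smul_smul, eq_comm] using
      intervalIntegral.smul_integral_comp_mul_right (a := 0) (b := 1) (fun s => G (s • z)) r
  have hray : HasDerivAt (fun r : ℝ => r • z) z 1 := by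
    simpa using (hasDerivAt_id (1 : ℝ)).smul_const z
  have hmean : HasDerivAt (fun r : ℝ => radialMean G (r • z)) (fderiv ℝ (radialMean G) z z) 1 := by
    exact ((contDiff_radialMean hG).differentiable (by simp) z).hasFDerivAt.comp_hasDerivAt_of_eq
      (1 : ℝ) hray (one_smul ℝ z).symm
  have hprod := (hasDerivAt_id (1 : ℝ)).mul hmean
  have hint := intervalIntegral.integral_hasDerivAt_right (hcont.intervalIntegrable 0 1)
    (hcont.stronglyMeasurableAtFilter _ _) hcont.continuousAt
  simp only [hscale] at hint
  simpa [add_comm] using hprod.unique hint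

theorem exists_contDiff_eq_mul_of_vanish {f : E → ℝ} (hf : ContDiff ℝ ∞ f) {L : E →L[ℝ] ℝ}
    (hL : L ≠ 0) (hvanish : ∀ z, L z = 0 → f z = 0) :
    ∃ g : E → ℝ, ContDiff ℝ ∞ g ∧ ∀ z, f z = L z * g z := by
  obtain ⟨e, he⟩ : ∃ e, L e = 1 := by
    obtain ⟨v, hv⟩ := DFunLike.ne_iff.1 hL
    exact ⟨(L v)⁻¹ • v, by simpa using inv_mul_cancel₀ hv⟩
  refine ⟨fun z => ∫ s in (0 : ℝ)..1, fderiv ℝ f ((z - L z • e) + s • (L z • e)) e, ?_, ?_⟩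
  · refine contDiff_integral_unitInterval
      (f := fun q : E × ℝ => fderiv ℝ f ((q.1 - L q.1 • e) + q.2 • (L q.1 • e)) e) ?_
    exact ((hf.fderiv_right (m := ∞) (by simp)).comp (by fun_prop)).clm_apply contDiff_const
  · intro z
    have htaylor := map_add_eq_add_integral_fderiv (hf.of_le (by simp)) (z - L z • e) (L z • e)
    rw [sub_add_cancel, hvanish (z - L z • e) (by simp [he]), zero_add] at htaylor
    simpa using htaylor

end Segment

section Localization

variable {E : Type*} [NormedAddCommGroup E] [NormedSpace ℝ E]

theorem exists_contDiff_eventuallyEq [FiniteDimensional ℝ E] {O : Set E} (hO : IsOpen O) {a : E}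
    (ha : a ∈ O) {f : E → ℝ} (hf : ContDiffOn ℝ ∞ f O) :
    ∃ g : E → ℝ, ContDiff ℝ ∞ g ∧ g =ᶠ[𝓝 a] f ∧ Function.support g ⊆ O ∩ Function.support f := by
  obtain ⟨r, hr, hrO⟩ := Metric.nhds_basis_closedBall.mem_iff.1 (hO.mem_nhds ha)
  let b : ContDiffBump a := ⟨r / 2, r, by positivity, by linarith⟩
  have hbO : tsupport b ⊆ O := b.tsupport_eq ▸ hrO
  refine ⟨fun z => b z * f z, ?_, b.eventuallyEq_one.mono fun z hz => by simp [hz], fun z hz =>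
    ⟨hbO (subset_tsupport _ (left_ne_zero_of_mul hz)), right_ne_zero_of_mul hz⟩⟩
  refine contMDiff_iff_contDiff.1 (contMDiff_of_tsupport fun z hz => ?_)
  have hzO : z ∈ O := hbO (tsupport_mul_subset_left hz)
  exact (b.contDiff.contDiffAt.mul (hf.contDiffAt (hO.mem_nhds hzO))).contMDiffAt

variable {F G : Type*} [NormedAddCommGroup F] [NormedSpace ℝ F] [NormedAddCommGroup G]
  [NormedSpace ℝ G] [CompleteSpace E]

theorem exists_openPartialHomeomorph_of_eventually_contDiffAt {f : E → F} {a : E}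
    {f' : E ≃L[ℝ] F} (hf : ∀ᶠ z in 𝓝 a, ContDiffAt ℝ ∞ f z)
    (hf' : HasFDerivAt f (f' : E →L[ℝ] F) a) {O : Set E} (hO : O ∈ 𝓝 a) :
    ∃ e : OpenPartialHomeomorph E F, a ∈ e.source ∧ e.source ⊆ O ∧ (∀ z, e z = f z) ∧
      ContDiffOn ℝ ∞ e.symm e.target := by
  have hfa := hf.self_of_nhds
  have hinv : ∀ᶠ z in 𝓝 a, fderiv ℝ f z ∈ range ((↑) : (E ≃L[ℝ] F) → E →L[ℝ] F) :=
    (hfa.continuousAt_fderiv (by simp)).eventually_mem (hf'.fderiv ▸ f'.nhds)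
  obtain ⟨O', hO', hO'open, haO'⟩ := mem_nhds_iff.1 ((hf.and hinv).and hO)
  let e := (hfa.toOpenPartialHomeomorph f hf' (by simp)).restrOpen O' hO'open
  have hsource : e.source = (hfa.toOpenPartialHomeomorph f hf' (by simp)).source ∩ O' := rfl
  refine ⟨e, ⟨hfa.mem_toOpenPartialHomeomorph_source hf' (by simp), haO'⟩,
    fun z hz => (hO' hz.2).2, fun z => rfl, fun w hw => ?_⟩
  obtain ⟨⟨hsmooth, g', hg'⟩, -⟩ := hO' (hsource ▸ e.map_target hw).2
  exact (e.contDiffAt_symm hw (hg' ▸ (hsmooth.differentiableAt (by simp)).hasFDerivAt)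
    hsmooth).contDiffWithinAt

variable [CompleteSpace F] [CompleteSpace G]

theorem contDiffAt_of_eventually_apply_eq {f : E × F → G} {ρ : E → F} {a : E} {n : ℕ∞ω}
    (hn : n ≠ 0) (hf : ContDiffAt ℝ n f (a, ρ a))
    (hinv : (fderiv ℝ f (a, ρ a) ∘L .inr ℝ E F).IsInvertible) (hρ : ContinuousAt ρ a)
    (heq : ∀ᶠ z in 𝓝 a, f (z, ρ z) = f (a, ρ a)) : ContDiffAt ℝ n ρ a := by
  refine (hf.contDiffAt_implicitFunction hn hinv).congr_of_eventuallyEq ?_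
  filter_upwards [heq, (continuousAt_id.prodMk hρ).eventually
    (hf.eventually_apply_eq_iff_implicitFunction hn hinv)] with z hz himplicit
  exact (himplicit.1 hz).symm

theorem exists_eventually_contDiffAt_of_implicit {f : E × F → G} {u : E × F} {W : Set (E × F)}
    (hW : W ∈ 𝓝 u) (hf : ∀ᶠ q in 𝓝 u, ContDiffAt ℝ ∞ f q)
    (hinv : (fderiv ℝ f u ∘L .inr ℝ E F).IsInvertible) :
    ∃ ρ : E → F, ρ u.1 = u.2 ∧ ∀ᶠ z in 𝓝 u.1,
      ContDiffAt ℝ ∞ ρ z ∧ (z, ρ z) ∈ W ∧ f (z, ρ z) = f u := by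
  have hfu : ContDiffAt ℝ ∞ f u := hf.self_of_nhds
  set ρ := hfu.implicitFunction (by simp) hinv
  have hρu : ρ u.1 = u.2 := hfu.implicitFunction_apply_self (by simp) hinv
  have hρ : ContDiffAt ℝ ∞ ρ u.1 := hfu.contDiffAt_implicitFunction (by simp) hinv
  have hgraph : Tendsto (fun z => (z, ρ z)) (𝓝 u.1) (𝓝 u) := by
    simpa [hρu] using (continuousAt_id.prodMk hρ.continuousAt).tendsto
  have hinv' : ∀ᶠ q in 𝓝 u, (fderiv ℝ f q ∘L .inr ℝ E F).IsInvertible := by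
    obtain ⟨f', hf'⟩ := hinv
    have hcont : ContinuousAt (fun q => fderiv ℝ f q ∘L .inr ℝ E F) u :=
      (hfu.continuousAt_fderiv (by simp)).clm_comp continuousAt_const
    filter_upwards [hcont.eventually_mem (hf' ▸ f'.nhds)] with q hq using hq
  have heq : ∀ᶠ z in 𝓝 u.1, f (z, ρ z) = f u :=
    hfu.eventually_apply_implicitFunction (by simp) hinv
  have hcont : ∀ᶠ z in 𝓝 u.1, ContinuousAt ρ z :=
    ((hρ.of_le (m := 1) (by simp)).eventually (by simp)).mono fun z hz => hz.continuousAt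
  refine ⟨ρ, hρu, ?_⟩
  filter_upwards [heq.eventually_nhds, hcont, hgraph.eventually (hf.and (hinv'.and hW))]
    with z hz hρz ⟨hfz, hinvz, hWz⟩
  exact ⟨contDiffAt_of_eventually_apply_eq (by simp) hfz hinvz hρz
    (hz.mono fun w hw => hw.trans hz.self_of_nhds.symm), hWz, hz.self_of_nhds⟩

end Localization

end Analysis

open Filter Topology

section HomogeneousPolynomial

variable {ι : Type*} [Fintype ι]

theorem contDiff_eval_mvPolynomial (h : MvPolynomial ι ℝ) :
    ContDiff ℝ ∞ fun z : EuclideanSpace ℝ ι => MvPolynomial.eval z.ofLp h := by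
  simp only [MvPolynomial.eval_eq']
  fun_prop

theorem eval_smul_of_isHomogeneous {R σ : Type*} [CommSemiring R] {h : MvPolynomial σ R} {m : ℕ}
    (hh : h.IsHomogeneous m) (r : R) (z : σ → R) :
    MvPolynomial.eval (r • z) h = r ^ m * MvPolynomial.eval z h := by
  rw [MvPolynomial.eval_eq, MvPolynomial.eval_eq, Finset.mul_sum]
  refine Finset.sum_congr rfl fun d hd => ?_
  have hdeg : ∑ i ∈ d.support, d i = m := by
    rw [← hh (MvPolynomial.mem_support_iff.1 hd)]
    exact DFunLike.congr_fun Finsupp.degree_eq_weight_one d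
  simp only [Pi.smul_apply, smul_eq_mul, mul_pow, Finset.prod_mul_distrib,
    Finset.prod_pow_eq_pow_sum, hdeg]
  ring

theorem exists_eq_add_sum_coord_mul {F : EuclideanSpace ℝ ι → ℝ} (hF : ContDiff ℝ ∞ F) :
    ∃ G : ι → EuclideanSpace ℝ ι → ℝ, (∀ i, ContDiff ℝ ∞ (G i)) ∧
      ∀ z, F z = F 0 + ∑ i, z i * G i z := by
  classical
  have hpartial (i : ι) : ContDiff ℝ ∞ fun z => fderiv ℝ F z (EuclideanSpace.single i (1 : ℝ)) :=
    (hF.fderiv_right (m := ∞) (by simp)).clm_apply contDiff_const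
  refine ⟨fun i => radialMean _, fun i => contDiff_radialMean (hpartial i), fun z => ?_⟩
  have hcont (i : ι) : Continuous fun s : ℝ =>
      z i * fderiv ℝ F (s • z) (EuclideanSpace.single i (1 : ℝ)) :=
    continuous_const.mul ((hpartial i).continuous.comp (by fun_prop))
  have htaylor := map_add_eq_add_integral_fderiv (hF.of_le (by simp)) 0 z
  simp only [zero_add] at htaylor
  simp only [htaylor, radialMean, ← intervalIntegral.integral_const_mul]
  rw [← intervalIntegral.integral_finsetSum fun i _ => (hcont i).intervalIntegrable _ _]
  congr 1
  refine intervalIntegral.integral_congr fun s _ => ?_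
  have hz : z = ∑ i, z i • EuclideanSpace.single i (1 : ℝ) := by
    simpa using ((EuclideanSpace.basisFun ι ℝ).sum_repr z).symm
  simpa only [map_sum, map_smul, smul_eq_mul] using congrArg (fderiv ℝ F (s • z)) hz

theorem fderiv_sum_coord_mul_apply_self {A : ι → EuclideanSpace ℝ ι → ℝ}
    (hA : ∀ i, Differentiable ℝ (A i)) (c : ℝ) (z : EuclideanSpace ℝ ι) :
    fderiv ℝ (fun z => c + ∑ i, z i * A i z) z z = ∑ i, z i * (fderiv ℝ (A i) z z + A i z) := by
  have hderiv : HasFDerivAt (fun z => c + ∑ i, z i * A i z) _ z :=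
    (HasFDerivAt.fun_sum fun i (_ : i ∈ Finset.univ) =>
      (EuclideanSpace.proj (𝕜 := ℝ) i).hasFDerivAt.mul (hA i z).hasFDerivAt).const_add c
  rw [hderiv.fderiv, sum_apply]
  refine Finset.sum_congr rfl fun i _ => ?_
  simp only [add_apply, smul_apply, PiLp.proj_apply, smul_eq_mul]
  ring

theorem exists_radial_primitive (m : ℕ) {F : EuclideanSpace ℝ ι → ℝ} (hF : ContDiff ℝ ∞ F) :
    ∃ (A : EuclideanSpace ℝ ι → ℝ) (h : MvPolynomial ι ℝ), ContDiff ℝ ∞ A ∧ h.IsHomogeneous m ∧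
      ∀ z, fderiv ℝ A z z - m * A z = F z - MvPolynomial.eval z.ofLp h := by
  have hcoord (i : ι) : ContDiff ℝ ∞ fun z : EuclideanSpace ℝ ι => z i :=
    (EuclideanSpace.proj (𝕜 := ℝ) i).contDiff
  induction m generalizing F with
  | zero =>
    obtain ⟨G, hG, hFG⟩ := exists_eq_add_sum_coord_mul hF
    have hmean (i : ι) := contDiff_radialMean (hG i)
    refine ⟨fun z => 0 + ∑ i, z i * radialMean (G i) z, MvPolynomial.C (F 0),
      contDiff_const.add (ContDiff.sum fun i _ => (hcoord i).mul (hmean i)),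
      MvPolynomial.isHomogeneous_C _ _, fun z => ?_⟩
    rw [fderiv_sum_coord_mul_apply_self (fun i => (hmean i).differentiable (by simp)), hFG z]
    simp only [fderiv_radialMean_apply_self (hG _), MvPolynomial.eval_C, Nat.cast_zero]
    ring
  | succ m ih =>
    obtain ⟨G, hG, hFG⟩ := exists_eq_add_sum_coord_mul hF
    choose A h hA hh hAh using fun i => ih (hG i)
    refine ⟨fun z => -F 0 / (m + 1) + ∑ i, z i * A i z, ∑ i, MvPolynomial.X i * h i,
      contDiff_const.add (ContDiff.sum fun i _ => (hcoord i).mul (hA i)),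
      MvPolynomial.IsHomogeneous.sum _ _ _ fun i _ => ?_, fun z => ?_⟩
    · simpa [add_comm] using (MvPolynomial.isHomogeneous_X ℝ i).mul (hh i)
    · rw [fderiv_sum_coord_mul_apply_self (fun i => (hA i).differentiable (by simp)), hFG z]
      have hm : (m : ℝ) + 1 ≠ 0 := by positivity
      have hsum : ∑ i, z i * (fderiv ℝ (A i) z z + A i z) - (m + 1) * ∑ i, z i * A i z =
          ∑ i, z i * G i z - ∑ i, z i * MvPolynomial.eval z.ofLp (h i) := by
        simp only [Finset.mul_sum, ← Finset.sum_sub_distrib]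
        exact Finset.sum_congr rfl fun i _ => by linear_combination z i * hAh i z
      simp only [map_sum, map_mul, MvPolynomial.eval_X]
      push_cast
      field_simp
      linear_combination hsum

end HomogeneousPolynomial

section RadialScaling

variable {E : Type*} [NormedAddCommGroup E] [NormedSpace ℝ E] {A F h : E → ℝ} {m : ℕ}

/-- The function `Φ (z, r) = A (r z) / r ^ m + h z log r`. If `(E - m) A = F - h` for the Euler
field `E`, with `h` homogeneous of degree `m`, then its level sets are the graphs of the radial
factors `ρ` for which `(ρ + E ρ) F (ρ z) / ρ ^ (m + 1)` is `h` up to a constant. -/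
noncomputable def radialPotential (m : ℕ) (A h : E → ℝ) (q : E × ℝ) : ℝ :=
  A (q.2 • q.1) / q.2 ^ m + h q.1 * Real.log q.2

theorem contDiffAt_radialPotential (hA : ContDiff ℝ ∞ A) (hh : ContDiff ℝ ∞ h) {q : E × ℝ}
    (hq : q.2 ≠ 0) : ContDiffAt ℝ ∞ (radialPotential m A h) q :=
  ((hA.comp (contDiff_snd.smul contDiff_fst)).contDiffAt.div (contDiff_snd.pow m).contDiffAt
    (pow_ne_zero m hq)).add ((hh.comp contDiff_fst).contDiffAt.mul (contDiff_snd.contDiffAt.log hq))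

theorem fderiv_radialPotential_apply (hA : ContDiff ℝ ∞ A) (hh : ContDiff ℝ ∞ h)
    (hom : ∀ (r : ℝ) z, h (r • z) = r ^ m * h z)
    (hAF : ∀ z, fderiv ℝ A z z - m * A z = F z - h z) (z : E) {r : ℝ} (hr : r ≠ 0) (a b : ℝ) :
    fderiv ℝ (radialPotential m A h) (z, r) (a • z, b) =
      a * (m * radialPotential m A h (z, r) - h z) + (a * r + b) * (F (r • z) / r ^ (m + 1)) := by
  have hdil : HasDerivAt (fun t : ℝ => 1 + t * a) a 0 := by
    simpa using ((hasDerivAt_id (0 : ℝ)).mul_const a).const_add 1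
  have hshift : HasDerivAt (fun t : ℝ => r + t * b) b 0 := by
    simpa using ((hasDerivAt_id (0 : ℝ)).mul_const b).const_add r
  have hcurve : HasDerivAt (fun t : ℝ => radialPotential m A h ((1 + t * a) • z, r + t * b))
      (fderiv ℝ (radialPotential m A h) (z, r) (a • z, b)) 0 :=
    (((contDiffAt_radialPotential hA hh hr).differentiableAt (by simp)).hasFDerivAt
      |>.comp_hasDerivAt_of_eq 0 ((hdil.smul_const z).prodMk hshift) (by simp))
  have hAcurve : HasDerivAt (fun t : ℝ => A ((r + t * b) • (1 + t * a) • z))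
      (fderiv ℝ A (r • z) (r • a • z + b • z)) 0 := by
    refine (hA.differentiable (by simp) (r • z)).hasFDerivAt.comp_hasDerivAt_of_eq 0 ?_ (by simp)
    simpa using hshift.fun_smul (hdil.smul_const z)
  have hhcurve : HasDerivAt (fun t : ℝ => h ((1 + t * a) • z)) (a * (m * h z)) 0 := by
    simpa [hom, mul_comm, mul_left_comm] using (hdil.fun_pow m).mul_const (h z)
  have hsum := (hAcurve.fun_div (hshift.fun_pow m) (by simpa using pow_ne_zero m hr)).fun_add
    (hhcurve.fun_mul (hshift.log (by simpa using hr)))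
  rw [hcurve.unique hsum]
  have hpow : m * r ^ (m - 1) = m * r ^ m / r := by
    cases m with
    | zero => simp
    | succ m => rw [Nat.add_sub_cancel, pow_succ]; field_simp
  have hAr : F (r • z) = r * fderiv ℝ A (r • z) z - m * A (r • z) + r ^ m * h z := by
    have := hAF (r • z)
    rw [map_smul, smul_eq_mul, hom] at this
    linarith
  simp only [map_add, map_smul, smul_eq_mul, zero_mul, add_zero, one_smul, hAr,
    radialPotential, hpow]
  field_simp
  ring

theorem exists_radial_factor [CompleteSpace E] (hA : ContDiff ℝ ∞ A) (hh : ContDiff ℝ ∞ h)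
    (hom : ∀ (r : ℝ) z, h (r • z) = r ^ m * h z)
    (hAF : ∀ z, fderiv ℝ A z z - m * A z = F z - h z) (hF0 : F 0 ≠ 0) {r₀ : ℝ} (hr₀ : r₀ ≠ 0) :
    ∃ ρ : E → ℝ, ρ 0 = r₀ ∧ ∀ᶠ z in 𝓝 0, ContDiffAt ℝ ∞ ρ z ∧ ρ z ≠ 0 ∧
      (ρ z + fderiv ℝ ρ z z) * F (ρ z • z) = (F 0 / r₀ ^ m + (h z - h 0)) * ρ z ^ (m + 1) := by
  set Φ := radialPotential m A h with hΦ
  have hW : {q : E × ℝ | q.2 ≠ 0} ∈ 𝓝 ((0 : E), r₀) :=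
    (isOpen_ne.preimage continuous_snd).mem_nhds hr₀
  have hsmooth (q : E × ℝ) (hq : q.2 ≠ 0) : ContDiffAt ℝ ∞ Φ q :=
    contDiffAt_radialPotential hA hh hq
  have hpartial : fderiv ℝ Φ (0, r₀) (0, 1) = F 0 / r₀ ^ (m + 1) := by
    simpa using fderiv_radialPotential_apply hA hh hom hAF 0 hr₀ 0 1
  have hinv : (fderiv ℝ Φ (0, r₀) ∘L .inr ℝ E ℝ).IsInvertible := by
    refine ⟨.unitsEquivAut ℝ (Units.mk0 _ (div_ne_zero hF0 (pow_ne_zero (m + 1) hr₀))), ?_⟩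
    ext
    simp [hpartial]
  obtain ⟨ρ, hρ0, hρ⟩ := exists_eventually_contDiffAt_of_implicit hW
    (eventually_of_mem hW fun q hq => hsmooth q hq) hinv
  have hlevel : ∀ᶠ z in 𝓝 0, (ρ z + fderiv ℝ ρ z z) * F (ρ z • z) =
      (h z - m * Φ (0, r₀)) * ρ z ^ (m + 1) := by
    filter_upwards [hρ.eventually_nhds] with z hz
    obtain ⟨hρz, hne : ρ z ≠ 0, hval⟩ := hz.self_of_nhds
    have hgraph : HasFDerivAt (fun w => Φ (w, ρ w)) _ z :=
      ((hsmooth (z, ρ z) hne).differentiableAt (by simp)).hasFDerivAt.comp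
        (f := fun w => (w, ρ w)) z
        ((hasFDerivAt_id z).prodMk (hρz.differentiableAt (by simp)).hasFDerivAt)
    have hconst : HasFDerivAt (fun w => Φ (w, ρ w)) (0 : E →L[ℝ] ℝ) z :=
      (hasFDerivAt_const (Φ (0, r₀)) z).congr_of_eventuallyEq (hz.mono fun w hw => hw.2.2)
    have hzero : fderiv ℝ Φ (z, ρ z) (z, fderiv ℝ ρ z z) = 0 :=
      DFunLike.congr_fun (hgraph.unique hconst) z
    have happly := fderiv_radialPotential_apply hA hh hom hAF z hne 1 (fderiv ℝ ρ z z)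
    rw [one_smul, ← hΦ, hzero, hval] at happly
    field_simp at happly
    linear_combination -happly
  have hconst : h 0 - m * Φ (0, r₀) = F 0 / r₀ ^ m := by
    have := hlevel.self_of_nhds
    simp only [smul_zero, map_zero, add_zero, hρ0] at this
    field_simp
    apply mul_left_cancel₀ hr₀
    linear_combination -this
  refine ⟨ρ, hρ0, ?_⟩
  filter_upwards [hρ, hlevel] with z hz hlevel
  exact ⟨hz.1, hz.2.1, by rw [hlevel, ← hconst]; ring⟩

end RadialScaling

theorem isHomogeneous_sub_C_coeff_zero {R ι : Type*} [CommRing R] {h : MvPolynomial ι R} {m : ℕ}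
    (hh : h.IsHomogeneous m) : (h - MvPolynomial.C (h.coeff 0)).IsHomogeneous m := by
  cases m with
  | zero =>
    rw [← MvPolynomial.totalDegree_eq_zero_iff_eq_C.1
      (Nat.le_zero.1 hh.totalDegree_le), sub_self]
    exact MvPolynomial.isHomogeneous_zero _ _ _
  | succ m => simpa [hh.coeff_eq_zero (d := 0) (by simp)] using hh

theorem exists_radial_scaling {ι : Type*} [Fintype ι] {F : EuclideanSpace ℝ ι → ℝ}
    (hF : ContDiff ℝ ∞ F) (hF0 : F 0 ≠ 0) (m : ℕ) {r₀ : ℝ} (hr₀ : r₀ ≠ 0) :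
    ∃ (h : MvPolynomial ι ℝ) (ρ : EuclideanSpace ℝ ι → ℝ), h.IsHomogeneous m ∧ h.coeff 0 = 0 ∧
      ρ 0 = r₀ ∧
      ∀ᶠ z in 𝓝 0, ContDiffAt ℝ ∞ ρ z ∧ ρ z ≠ 0 ∧ (ρ z + fderiv ℝ ρ z z) * F (ρ z • z) =
        (F 0 / r₀ ^ m + MvPolynomial.eval z.ofLp h) * ρ z ^ (m + 1) := by
  obtain ⟨A, h, hA, hh, hAh⟩ := exists_radial_primitive m hF
  have hom (r : ℝ) (z : EuclideanSpace ℝ ι) :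
      MvPolynomial.eval (r • z).ofLp h = r ^ m * MvPolynomial.eval z.ofLp h := by
    rw [WithLp.ofLp_smul, eval_smul_of_isHomogeneous hh]
  obtain ⟨ρ, hρ0, hρ⟩ := exists_radial_factor hA (contDiff_eval_mvPolynomial h) hom hAh hF0 hr₀
  have heval (z : EuclideanSpace ℝ ι) :
      MvPolynomial.eval z.ofLp (h - MvPolynomial.C (h.coeff 0)) =
        MvPolynomial.eval z.ofLp h - MvPolynomial.eval (0 : EuclideanSpace ℝ ι).ofLp h := by
    simp [MvPolynomial.eval_zero, MvPolynomial.constantCoeff_eq]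
  refine ⟨h - MvPolynomial.C (h.coeff 0), ρ, isHomogeneous_sub_C_coeff_zero hh, by simp, hρ0, ?_⟩
  simp only [heval]
  exact hρ

section PartialFractions

variable {K ι : Type*} [Field K] {m : ℕ} {s : Finset ι} {a b : ι → K}
  {h : MvPolynomial (Fin 2) K}

open MvPolynomial (aeval eval)

theorem eval_vec_mul_eq (hh : h.IsHomogeneous m) (x t : K) :
    eval ![x, x * t] h = x ^ m * (aeval ![1, Polynomial.X] h : Polynomial K).eval t := by
  have hvec : ![x, x * t] = x • ![1, t] := by simp
  have hcoeff : (Polynomial.evalRingHom t).comp (algebraMap K (Polynomial K)) = .id K := by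
    ext; simp
  have hcoord : (fun i => Polynomial.evalRingHom t ((![1, Polynomial.X] : Fin 2 → _) i)) =
      ![1, t] := by
    ext i; fin_cases i <;> simp
  rw [hvec, eval_smul_of_isHomogeneous hh, ← Polynomial.coe_evalRingHom,
    MvPolynomial.map_aeval, hcoeff, hcoord, MvPolynomial.eval]

theorem natDegree_aeval_one_X_le (hh : h.IsHomogeneous m) :
    (aeval ![1, Polynomial.X] h : Polynomial K).natDegree ≤ m := by
  simpa using MvPolynomial.aeval_natDegree_le (n := 1) h hh.totalDegree_le _
    fun i => by fin_cases i <;> simp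

theorem exists_partialFractions (hh : h.IsHomogeneous m) (hms : m + 1 = s.card)
    (hb : ∀ i ∈ s, b i ≠ 0) (hab : (s : Set ι).Pairwise fun i j => a i * b j ≠ a j * b i) :
    ∃ ν : ι → K, ∀ x y, x ≠ 0 → (∀ i ∈ s, a i * x + b i * y ≠ 0) →
      eval ![x, y] h / ∏ i ∈ s, (a i * x + b i * y) = ∑ i ∈ s, ν i / (a i * x + b i * y) := by
  classical
  -- Lagrange interpolation of `h (1, t)` at the slopes of the lines
  let f : Polynomial K := aeval ![1, Polynomial.X] h
  let slope (i : ι) : K := -a i / b i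
  have hslope : Set.InjOn slope s := fun i hi j hj hij => by
    by_contra hne
    refine hab hi hj hne ?_
    have := (div_eq_div_iff (hb i hi) (hb j hj)).1 hij
    linear_combination -this
  have hdeg : f.degree < s.card :=
    (Polynomial.natDegree_le_iff_degree_le.1 (natDegree_aeval_one_X_le hh)).trans_lt
      (by exact_mod_cast (by omega : m < s.card))
  refine ⟨fun i => Lagrange.nodalWeight s slope i * f.eval (slope i) * b i / ∏ j ∈ s, b j,
    fun x y hx hL => ?_⟩
  obtain ⟨t, rfl⟩ : ∃ t, y = x * t := ⟨y / x, (mul_div_cancel₀ y hx).symm⟩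
  have hline (i : ι) (hi : i ∈ s) : a i * x + b i * (x * t) = b i * x * (t - slope i) := by
    have := hb i hi
    simp only [slope]
    field_simp
    ring
  have hnode (i : ι) (hi : i ∈ s) : t - slope i ≠ 0 :=
    right_ne_zero_of_mul (hline i hi ▸ hL i hi)
  have hinterp := congrArg (Polynomial.eval t) (Lagrange.eq_interpolate hslope hdeg)
  rw [Lagrange.eval_interpolate_not_at_node _ fun i hi => sub_ne_zero.1 (hnode i hi),
    Lagrange.eval_nodal] at hinterp
  have hprod : ∏ i ∈ s, (a i * x + b i * (x * t)) =
      (∏ i ∈ s, b i) * x ^ (m + 1) * ∏ i ∈ s, (t - slope i) := by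
    rw [Finset.prod_congr rfl hline, Finset.prod_mul_distrib, Finset.prod_mul_distrib,
      Finset.prod_const, hms]
  have hb' := Finset.prod_ne_zero_iff.2 hb
  have hnode' := Finset.prod_ne_zero_iff.2 hnode
  rw [eval_vec_mul_eq hh, hinterp, hprod, div_eq_iff (by positivity),
    Finset.mul_sum, Finset.mul_sum, Finset.sum_mul]
  refine Finset.sum_congr rfl fun i hi => ?_
  rw [hline i hi]
  have := hb i hi
  have := hnode i hi
  field_simp
  ring

theorem div_mul_eq_add_div_line (ν : K) {a b x y : K} (hx : x ≠ 0) (hy : y ≠ 0)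
    (hL : a * x + b * y ≠ 0) :
    ν / (x * y) = ν * b / (x * (a * x + b * y)) + ν * a / (y * (a * x + b * y)) := by
  rw [div_add_div _ _ (mul_ne_zero hx hL) (mul_ne_zero hy hL), div_eq_div_iff
    (mul_ne_zero hx hy) (mul_ne_zero (mul_ne_zero hx hL) (mul_ne_zero hy hL))]
  ring

theorem exists_normalForm_coefficients (hh : h.IsHomogeneous s.card) (hh0 : h.coeff 0 = 0)
    (ha : ∀ i ∈ s, a i ≠ 0) (hb : ∀ i ∈ s, b i ≠ 0)
    (hab : (s : Set ι).Pairwise fun i j => a i * b j ≠ a j * b i) :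
    ∃ lam del : ι → K, ∀ x y, x ≠ 0 → y ≠ 0 → (∀ i ∈ s, a i * x + b i * y ≠ 0) →
      eval ![x, y] h / (x * y * ∏ i ∈ s, (a i * x + b i * y)) =
        ∑ i ∈ s, (lam i / (x * (a i * x + b i * y)) + del i / (y * (a i * x + b i * y))) := by
  classical
  obtain rfl | ⟨e, he⟩ := s.eq_empty_or_nonempty
  · have hh' : h = 0 := by
      rw [MvPolynomial.totalDegree_eq_zero_iff_eq_C.1 (Nat.le_zero.1 hh.totalDegree_le), hh0,
        map_zero]
    exact ⟨0, 0, by simp [hh']⟩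
  obtain ⟨ν, hν⟩ := exists_partialFractions (s := s.insertNone) (a := fun i => i.elim 0 a)
    (b := fun i => i.elim 1 b) hh (by simp) (by
      rintro (_ | i) hi
      · exact one_ne_zero
      · exact hb i (Finset.some_mem_insertNone.1 hi)) (by
      rintro (_ | i) hi (_ | j) hj hij
      · exact absurd rfl hij
      · simpa [eq_comm] using ha j (by simpa using hj)
      · simpa using ha i (by simpa using hi)
      · simpa using hab (by simpa using hi) (by simpa using hj) (by simpa using hij))
  -- `P` has no term `1 / (x y)`: the one coming from the line `y = 0` is rewritten through `e`
  refine ⟨fun i => ν (some i) + if i = e then ν none * b e else 0,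
    fun i => if i = e then ν none * a e else 0, fun x y hx hy hL => ?_⟩
  have hsum := hν x y hx (by
    rintro (_ | i) hi
    · simpa using hy
    · exact hL i (Finset.some_mem_insertNone.1 hi))
  simp only [Finset.prod_insertNone, Finset.sum_insertNone, Option.elim_none, Option.elim_some,
    zero_mul, one_mul, zero_add] at hsum
  rw [mul_assoc, mul_comm x, ← div_div, hsum]
  simp only [add_div, ite_div, zero_div, Finset.sum_add_distrib, Finset.sum_ite_eq', he, if_true]
  rw [div_div, mul_comm y x, div_mul_eq_add_div_line (ν none) hx hy (hL e he), Finset.sum_div,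
    add_comm, add_assoc]
  congr 1
  exact Finset.sum_congr rfl fun i _ => by rw [div_div, mul_comm]

end PartialFractions

section LinearForms

variable {ι E : Type*} [NormedAddCommGroup E] [NormedSpace ℝ E] {L : ι → E →L[ℝ] ℝ} {s : Finset ι}

theorem exists_eventually_prod_ne_zero {p : Submodule ℝ E}
    (hL : ∀ i ∈ s, ∃ v ∈ p, L i v ≠ 0) :
    ∃ v ∈ p, ∀ z, ∀ᶠ t in 𝓝[≠] (0 : ℝ), ∏ i ∈ s, L i (z + t • v) ≠ 0 := by
  obtain ⟨v, hvp, hv⟩ := Module.Dual.exists_forall_mem_ne_zero_of_forall_exists p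
    (fun i : s => (L i : E →ₗ[ℝ] ℝ)) fun i => hL i i.2
  refine ⟨v, hvp, fun z => ?_⟩
  simp only [Finset.prod_ne_zero_iff, map_add, map_smul, smul_eq_mul]
  refine s.eventually_all.2 fun i hi => ?_
  rcases eq_or_ne (L i z) 0 with hz | hz
  · filter_upwards [self_mem_nhdsWithin] with t ht
    simpa [hz] using And.intro ht (hv ⟨i, hi⟩)
  · have hcont : ContinuousAt (fun t : ℝ => L i z + t * L i v) 0 := by fun_prop
    exact (hcont.eventually_ne (by simpa using hz)).filter_mono nhdsWithin_le_nhds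

theorem exists_contDiff_eq_prod_mul [FiniteDimensional ℝ E] {f : E → ℝ} (hf : ContDiff ℝ ∞ f)
    (hne : ∀ i ∈ s, L i ≠ 0)
    (hL : (s : Set ι).Pairwise fun i j => ∃ v, L i v = 0 ∧ L j v ≠ 0)
    (hvanish : ∀ i ∈ s, ∀ z, L i z = 0 → f z = 0) :
    ∃ g : E → ℝ, ContDiff ℝ ∞ g ∧ ∀ z, f z = (∏ i ∈ s, L i z) * g z := by
  classical
  induction s using Finset.induction_on with
  | empty => exact ⟨f, hf, by simp⟩
  | insert i s his ih =>
    simp only [Finset.forall_mem_insert, Finset.coe_insert] at hne hvanish hL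
    obtain ⟨g, hg, hfg⟩ := ih hne.2 (hL.mono (Set.subset_insert _ _)) hvanish.2
    obtain ⟨v, (hv : L i v = 0), hprod⟩ :=
      exists_eventually_prod_ne_zero (L := L) (s := s) (p := (L i).ker) fun j hj =>
        hL (Set.mem_insert _ _) (Set.mem_insert_of_mem _ hj) (ne_of_mem_of_not_mem hj his).symm
    have hg0 : ∀ z, L i z = 0 → g z = 0 := by
      intro z hz
      have hlim : Tendsto (fun t : ℝ => g (z + t • v)) (𝓝[≠] 0) (𝓝 (g z)) := by
        have hcont : Continuous fun t : ℝ => g (z + t • v) := hg.continuous.comp (by fun_prop)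
        simpa using (hcont.tendsto 0).mono_left nhdsWithin_le_nhds
      refine tendsto_nhds_unique hlim (tendsto_const_nhds.congr' ?_)
      filter_upwards [hprod z] with t ht
      have hzero := hfg (z + t • v)
      rw [hvanish.1 _ (by simp [hz, hv]), eq_comm, mul_eq_zero] at hzero
      exact (hzero.resolve_left ht).symm
    obtain ⟨k, hk, hgk⟩ := exists_contDiff_eq_mul_of_vanish hg hne.1 hg0
    refine ⟨k, hk, fun z => ?_⟩
    rw [Finset.prod_insert his, hfg, hgk]
    ring

end LinearForms

section AreaForm

/-- The standard area form `dx ∧ dy` of the plane. -/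
noncomputable def areaForm : Plane [⋀^Fin 2]→L[ℝ] ℝ :=
  wedge (EuclideanSpace.proj 0) (EuclideanSpace.proj 1)

theorem areaForm_apply (v : Fin 2 → Plane) :
    areaForm v = v 0 0 * v 1 1 - v 1 0 * v 0 1 := rfl

theorem eq_smul_areaForm (η : Plane [⋀^Fin 2]→L[ℝ] ℝ) :
    η = η ![EuclideanSpace.single 0 1, EuclideanSpace.single 1 1] • areaForm := by
  let b := (EuclideanSpace.basisFun (Fin 2) ℝ).toBasis
  have hb : (b : Fin 2 → Plane) = ![EuclideanSpace.single 0 1, EuclideanSpace.single 1 1] := by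
    funext i
    fin_cases i <;> simp [b]
  ext v
  have hdet := DFunLike.congr_fun (η.toAlternatingMap.eq_smul_basis_det b) v
  rw [AlternatingMap.smul_apply, hb] at hdet
  simpa [b, Module.Basis.det_apply, Matrix.det_fin_two, Module.Basis.toMatrix_apply,
    areaForm_apply] using hdet

theorem areaForm_smul_eq_add (v w z : Plane) :
    areaForm ![v, w] • z = areaForm ![z, w] • v + areaForm ![v, z] • w := by
  ext i
  fin_cases i <;> simp [areaForm_apply] <;> ring

theorem areaForm_eq_zero_of_ker {L : Plane →L[ℝ] ℝ} (hL : L ≠ 0) {v w : Plane}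
    (hv : L v = 0) (hw : L w = 0) : areaForm ![v, w] = 0 := by
  by_contra h
  refine hL (ContinuousLinearMap.ext fun z => ?_)
  have hcramer := congrArg L (areaForm_smul_eq_add v w z)
  simpa [hv, hw, h] using hcramer

theorem areaForm_comp_radial (r : ℝ) (L : Plane →L[ℝ] ℝ) (z : Plane) :
    areaForm.compContinuousLinearMap (r • .id ℝ Plane + L.smulRight z) =
      (r * (r + L z)) • areaForm := by
  ext v
  have hcramer := congrArg L (areaForm_smul_eq_add (v 0) (v 1) z)
  simp only [areaForm_apply, map_add, map_smul, smul_eq_mul, Matrix.cons_val_zero,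
    Matrix.cons_val_one] at hcramer
  simp only [areaForm_apply, ContinuousAlternatingMap.compContinuousLinearMap_apply,
    ContinuousAlternatingMap.smul_apply, Function.comp_apply, add_apply, smul_apply,
    ContinuousLinearMap.smulRight_apply, ContinuousLinearMap.id_apply, PiLp.add_apply,
    PiLp.smul_apply, smul_eq_mul]
  linear_combination -r * hcramer

end AreaForm

section Chart

variable {S : Type*} [TopologicalSpace S] [ChartedSpace Plane S]
  {e : OpenPartialHomeomorph S Plane}

/-- The differential of a chart at `q`, as a map to the plane. -/
noncomputable def chartDeriv (e : OpenPartialHomeomorph S Plane) (q : S) :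
    TangentSpace (𝓡 2) q →L[ℝ] Plane :=
  mfderiv (𝓡 2) (𝓡 2) e q

/-- The vector field on the surface whose expression in the chart `e` is `V`. -/
noncomputable def chartField (e : OpenPartialHomeomorph S Plane) (V : Plane → Plane) (q : S) :
    TangentSpace (𝓡 2) q :=
  (chartDeriv e q).inverse (V (e q))

theorem linear_ne_zero_of_isSmoothClosedCurve {c : Set S} (hc : IsSmoothClosedCurve c)
    {L : Plane →L[ℝ] ℝ} (hcL : ∀ q ∈ e.source, q ∈ c ↔ L (e q) = 0) {p : S} (hp : p ∈ e.source)
    (hpc : p ∈ c) : L ≠ 0 := by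
  rintro rfl
  obtain ⟨U, f, hpU, hf⟩ := hc.2 p hpc
  refine hf.mfderiv_ne_zero p hpU hpc ?_
  have hf0 : f =ᶠ[𝓝 p] fun _ => 0 := by
    filter_upwards [hf.isOpen.mem_nhds hpU, e.open_source.mem_nhds hp] with q hq hq'
    exact (hf.mem_iff q hq).1 ((hcL q hq').2 rfl)
  rw [hf0.mfderiv_eq]
  exact mfderiv_const

theorem mdifferentiable_of_mem_maximalAtlas
    (he : e ∈ IsManifold.maximalAtlas (𝓡 2) ∞ S) : e.MDifferentiable (𝓡 2) (𝓡 2) :=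
  ⟨(contMDiffOn_of_mem_maximalAtlas he).mdifferentiableOn (by simp),
    (contMDiffOn_symm_of_mem_maximalAtlas he).mdifferentiableOn (by simp)⟩

theorem isInvertible_chartDeriv (he : e ∈ IsManifold.maximalAtlas (𝓡 2) ∞ S) {q : S}
    (hq : q ∈ e.source) : (chartDeriv e q).IsInvertible :=
  ⟨(mdifferentiable_of_mem_maximalAtlas he).mfderiv hq, rfl⟩

theorem chartDeriv_chartField (he : e ∈ IsManifold.maximalAtlas (𝓡 2) ∞ S) {q : S}
    (hq : q ∈ e.source) (V : Plane → Plane) : chartDeriv e q (chartField e V q) = V (e q) :=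
  (isInvertible_chartDeriv he hq).self_apply_inverse _

theorem hasMFDerivAt_chart (he : e ∈ IsManifold.maximalAtlas (𝓡 2) ∞ S) {q : S}
    (hq : q ∈ e.source) : HasMFDerivAt (𝓡 2) (𝓡 2) e q (chartDeriv e q) :=
  ((contMDiffAt_of_mem_maximalAtlas he hq).mdifferentiableAt (by simp)).hasMFDerivAt

theorem hasMFDerivAt_comp_chart (he : e ∈ IsManifold.maximalAtlas (𝓡 2) ∞ S) {q : S}
    (hq : q ∈ e.source) (L : Plane →L[ℝ] ℝ) :
    HasMFDerivAt (𝓡 2) 𝓘(ℝ, ℝ) (fun q => L (e q)) q (L.comp (chartDeriv e q)) :=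
  HasMFDerivAt.comp q L.hasMFDerivAt (hasMFDerivAt_chart he hq)

theorem mfderiv_comp_chart_apply (he : e ∈ IsManifold.maximalAtlas (𝓡 2) ∞ S) {q : S}
    (hq : q ∈ e.source) (L : Plane →L[ℝ] ℝ) (v : TangentSpace (𝓡 2) q) :
    mfderiv (𝓡 2) 𝓘(ℝ, ℝ) (fun q => L (e q)) q v = L (chartDeriv e q v) := by
  rw [(hasMFDerivAt_comp_chart he hq L).mfderiv]
  rfl

theorem isDefiningFunctionOn_linear (he : e ∈ IsManifold.maximalAtlas (𝓡 2) ∞ S) {c : Set S}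
    {L : Plane →L[ℝ] ℝ} (hL : L ≠ 0) (hc : ∀ q ∈ e.source, q ∈ c ↔ L (e q) = 0) :
    IsDefiningFunctionOn c e.source fun q => L (e q) where
  isOpen := e.open_source
  contMDiffOn := L.contMDiff.comp_contMDiffOn (contMDiffOn_of_mem_maximalAtlas he)
  mem_iff := hc
  mfderiv_ne_zero := by
    intro q hq _ h0
    refine hL (ContinuousLinearMap.ext fun z => ?_)
    obtain ⟨v, rfl⟩ := (isInvertible_chartDeriv he hq).bijective.surjective z
    rw [← mfderiv_comp_chart_apply he hq, h0]
    rfl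

theorem symm_mfderiv_chartDeriv (he : e ∈ IsManifold.maximalAtlas (𝓡 2) ∞ S) {q : S}
    (hq : q ∈ e.source) (v : TangentSpace (𝓡 2) q) :
    mfderiv (𝓡 2) (𝓡 2) e.symm (e q) (chartDeriv e q v) = v :=
  DFunLike.congr_fun ((mdifferentiable_of_mem_maximalAtlas he).symm_comp_deriv hq) v

theorem mfderiv_apply_eq_zero_of_eventually (he : e ∈ IsManifold.maximalAtlas (𝓡 2) ∞ S) {q : S}
    (hq : q ∈ e.source) {f : S → ℝ} (hf : MDifferentiableAt (𝓡 2) 𝓘(ℝ, ℝ) f q)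
    {v : TangentSpace (𝓡 2) q}
    (h0 : ∀ᶠ t in 𝓝 (0 : ℝ), f (e.symm (e q + t • chartDeriv e q v)) = 0) :
    mfderiv (𝓡 2) 𝓘(ℝ, ℝ) f q v = 0 := by
  have hfe : HasMFDerivAt (𝓡 2) 𝓘(ℝ, ℝ) (fun z => f (e.symm z)) (e q)
      ((mfderiv (𝓡 2) 𝓘(ℝ, ℝ) f (e.symm (e q))).comp (mfderiv (𝓡 2) (𝓡 2) e.symm (e q))) := by
    refine HasMFDerivAt.comp (e q) (MDifferentiableAt.hasMFDerivAt ?_)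
      (((mdifferentiable_of_mem_maximalAtlas he).mdifferentiableAt_symm
        (e.map_source hq)).hasMFDerivAt)
    rwa [e.left_inv hq]
  have hline := (hasMFDerivAt_iff_hasFDerivAt.1 hfe).hasLineDerivAt (chartDeriv e q v)
  have hzero := HasDerivAt.unique hline ((hasDerivAt_const 0 0).congr_of_eventuallyEq h0)
  have hv := symm_mfderiv_chartDeriv he hq v
  have hzero' : mfderiv (𝓡 2) 𝓘(ℝ, ℝ) f (e.symm (e q))
      (mfderiv (𝓡 2) (𝓡 2) e.symm (e q) (chartDeriv e q v)) = 0 := hzero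
  rw [hv] at hzero'
  rwa [e.left_inv hq] at hzero'

theorem mem_tangentLine_iff (he : e ∈ IsManifold.maximalAtlas (𝓡 2) ∞ S) {c : Set S}
    {L : Plane →L[ℝ] ℝ} (hL : L ≠ 0) (hc : ∀ q ∈ e.source, q ∈ c ↔ L (e q) = 0) {q : S}
    (hq : q ∈ e.source) (hqc : q ∈ c) (v : TangentSpace (𝓡 2) q) :
    v ∈ tangentLine c q ↔ L (chartDeriv e q v) = 0 := by
  refine ⟨fun hv => ?_, fun hv U f hqU hf => ?_⟩
  · rw [← mfderiv_comp_chart_apply he hq]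
    exact hv e.source _ hq (isDefiningFunctionOn_linear he hL hc)
  · refine mfderiv_apply_eq_zero_of_eventually he hq
      ((hf.contMDiffOn.contMDiffAt (hf.isOpen.mem_nhds hqU)).mdifferentiableAt (by simp)) ?_
    have hcont : ContinuousAt (fun t : ℝ => e q + t • chartDeriv e q v) 0 := by fun_prop
    have hnear : ∀ᶠ t in 𝓝 (0 : ℝ),
        e q + t • chartDeriv e q v ∈ e.target ∩ e.symm ⁻¹' U := by
      refine hcont.eventually_mem ((e.isOpen_inter_preimage_symm hf.isOpen).mem_nhds ?_)
      simp [hq, hqU]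
    filter_upwards [hnear] with t ht
    refine (hf.mem_iff _ ht.2).1 ((hc _ (e.map_target ht.1)).2 ?_)
    rw [e.right_inv ht.1, map_add, map_smul, hv, (hc q hq).1 hqc, smul_zero, add_zero]

theorem exists_eq_zero_ne_zero_of_transverse (he : e ∈ IsManifold.maximalAtlas (𝓡 2) ∞ S)
    {c c' : Set S} {L L' : Plane →L[ℝ] ℝ} (hL : L ≠ 0) (hL' : L' ≠ 0)
    (hc : ∀ q ∈ e.source, q ∈ c ↔ L (e q) = 0) (hc' : ∀ q ∈ e.source, q ∈ c' ↔ L' (e q) = 0)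
    {p : S} (hp : p ∈ e.source) (hpc : p ∈ c) (hpc' : p ∈ c')
    (ht : tangentLine c p ⊔ tangentLine c' p = ⊤) : ∃ v, L v = 0 ∧ L' v ≠ 0 := by
  by_contra! hker
  refine hL' (ContinuousLinearMap.ext fun z => ?_)
  obtain ⟨v, rfl⟩ := (isInvertible_chartDeriv he hp).bijective.surjective z
  obtain ⟨u, hu, w, hw, rfl⟩ := Submodule.mem_sup.1 (ht ▸ Submodule.mem_top (x := v))
  rw [map_add, map_add, hker _ ((mem_tangentLine_iff he hL hc hp hpc u).1 hu),
    (mem_tangentLine_iff he hL' hc' hp hpc' w).1 hw]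
  simp

theorem exists_eq_smul_areaForm_comp_chartDeriv (he : e ∈ IsManifold.maximalAtlas (𝓡 2) ∞ S)
    {q : S} (hq : q ∈ e.source) (η : (TangentSpace (𝓡 2) q) [⋀^Fin 2]→L[ℝ] ℝ) :
    ∃ κ : ℝ, η = κ • areaForm.compContinuousLinearMap (chartDeriv e q) := by
  obtain ⟨T, hT⟩ := isInvertible_chartDeriv he hq
  have harea := eq_smul_areaForm
    (η.compContinuousLinearMap (T.symm : Plane →L[ℝ] TangentSpace (𝓡 2) q))
  refine ⟨_, ContinuousAlternatingMap.ext fun v => Eq.trans ?_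
    (DFunLike.congr_fun harea (chartDeriv e q ∘ v))⟩
  simp only [ContinuousAlternatingMap.compContinuousLinearMap_apply, ← hT]
  congr 1
  ext i
  simp

variable [IsManifold (𝓡 2) ∞ S]

theorem contMDiffOn_chartField (he : e ∈ IsManifold.maximalAtlas (𝓡 2) ∞ S) {V : Plane → Plane}
    (hV : ContDiff ℝ ∞ V) : ContMDiffOn (𝓡 2) (𝓡 2).tangent ∞
      (fun q => (⟨q, chartField e V q⟩ : TangentBundle (𝓡 2) S)) e.source := by
  intro q hq
  have hVq : ContMDiffAt (𝓡 2) (𝓡 2).tangent ∞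
      (fun z => (⟨z, V z⟩ : TangentBundle (𝓡 2) Plane)) (e q) :=
    contMDiffAt_vectorSpace_iff_contDiffAt.2 hV.contDiffAt
  exact (ContMDiffAt.mpullback_vectorField_preimage (n := ∞) hVq
    (contMDiffAt_of_mem_maximalAtlas he hq) (isInvertible_chartDeriv he hq)
    (by simp)).contMDiffWithinAt

theorem contDiffOn_chartDeriv (he : e ∈ IsManifold.maximalAtlas (𝓡 2) ∞ S) {U : Set S}
    (hU : IsOpen U) {X : ∀ q : S, TangentSpace (𝓡 2) q}
    (hX : ContMDiffOn (𝓡 2) (𝓡 2).tangent ∞ (fun q => (⟨q, X q⟩ : TangentBundle (𝓡 2) S)) U) :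
    ContDiffOn ℝ ∞ (fun z => chartDeriv e (e.symm z) (X (e.symm z)))
      (e.target ∩ e.symm ⁻¹' U) := by
  rintro z ⟨hz, hzU⟩
  have hm := mdifferentiable_of_mem_maximalAtlas he
  have hpull : ContMDiffAt (𝓡 2) (𝓡 2).tangent ∞
      (fun z => (⟨z, VectorField.mpullback (𝓡 2) (𝓡 2) e.symm X z⟩ : TangentBundle (𝓡 2) Plane))
        z :=
    ContMDiffAt.mpullback_vectorField_preimage (n := ∞) (hX.contMDiffAt (hU.mem_nhds hzU))
      (contMDiffAt_symm_of_mem_maximalAtlas he hz) ⟨hm.symm.mfderiv hz, rfl⟩ (by simp)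
  refine ((contMDiffAt_vectorSpace_iff_contDiffAt.1 hpull).congr_of_eventuallyEq
    ?_).contDiffWithinAt
  filter_upwards [e.open_target.mem_nhds hz] with w hw
  have hinv : (mfderiv (𝓡 2) (𝓡 2) e.symm w).IsInvertible := ⟨hm.symm.mfderiv hw, rfl⟩
  have hXw := symm_mfderiv_chartDeriv he (e.map_target hw) (X (e.symm w))
  rw [e.right_inv hw] at hXw
  rw [VectorField.mpullback_apply]
  exact (hinv.inverse_apply_eq.2 hXw.symm).symm

end Chart

namespace StarChart

variable {S : Type*} [TopologicalSpace S] [ChartedSpace Plane S]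
  {n : ℕ} {D : StarDivisor S n} {p : S}

open Classical in
/-- The linear form cutting out the `i`-th curve in the star chart, normalized to `x` and `y` for
the first two curves through `p` (whose coefficients `A`, `B` are only determined up to scale). -/
noncomputable def form (χ : StarChart D p) (i : Fin n) : Plane →L[ℝ] ℝ :=
  if i = χ.α then EuclideanSpace.proj 0
  else if i = χ.β then EuclideanSpace.proj 1
  else χ.A i • EuclideanSpace.proj 0 + χ.B i • EuclideanSpace.proj 1

/-- The indices of all curves through `p`. -/
noncomputable def through (χ : StarChart D p) : Finset (Fin n) := insert χ.α (insert χ.β χ.others)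

/-- The denominator `x y ∏ L_i` of the normal form, as a function of the coordinates. -/
noncomputable def formProd (χ : StarChart D p) (z : Plane) : ℝ := ∏ i ∈ χ.through, χ.form i z

variable (χ : StarChart D p) {i j : Fin n}

theorem mem_others : i ∈ χ.others ↔ p ∈ D.curve i ∧ i ≠ χ.α ∧ i ≠ χ.β := by
  simp [others]

theorem mem_through : i ∈ χ.through ↔ p ∈ D.curve i := by
  simp only [through, Finset.mem_insert, mem_others]
  constructor
  · rintro (rfl | rfl | h)
    exacts [χ.α_mem, χ.β_mem, h.1]
  · tauto

theorem form_α (z : Plane) : χ.form χ.α z = z 0 := by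
  simp [form]

theorem form_β (z : Plane) : χ.form χ.β z = z 1 := by
  simp [form, χ.α_lt_β.ne']

theorem form_of_mem_others (hi : i ∈ χ.others) (z : Plane) :
    χ.form i z = χ.A i * z 0 + χ.B i * z 1 := by
  simp [form, (χ.mem_others.1 hi).2.1, (χ.mem_others.1 hi).2.2]

theorem β_notMem_others : χ.β ∉ χ.others := fun h => (χ.mem_others.1 h).2.2 rfl

theorem α_notMem_insert : χ.α ∉ insert χ.β χ.others := by
  simp [mem_others, χ.α_lt_β.ne]

theorem card_through : χ.through.card = χ.others.card + 2 := by
  rw [through, Finset.card_insert_of_notMem χ.α_notMem_insert,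
    Finset.card_insert_of_notMem χ.β_notMem_others]

theorem degree_eq : D.degree p = χ.others.card + 2 := by
  rw [← χ.card_through, StarDivisor.degree, ← Set.ncard_coe_finset]
  congr 1
  ext i
  simp [χ.mem_through]

theorem formProd_eq (z : Plane) :
    χ.formProd z = z 0 * z 1 * ∏ i ∈ χ.others, (χ.A i * z 0 + χ.B i * z 1) := by
  rw [formProd, through, Finset.prod_insert χ.α_notMem_insert,
    Finset.prod_insert χ.β_notMem_others, form_α, form_β, ← mul_assoc,
    Finset.prod_congr rfl fun i hi => χ.form_of_mem_others hi z]

theorem formProd_smul (r : ℝ) (z : Plane) :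
    χ.formProd (r • z) = r ^ (χ.others.card + 2) * χ.formProd z := by
  simp only [formProd, map_smul, smul_eq_mul, Finset.prod_mul_distrib, Finset.prod_const,
    card_through]

theorem mem_curve_iff_form (hi : p ∈ D.curve i) :
    ∀ q ∈ χ.chart.source, q ∈ D.curve i ↔ χ.form i (χ.chart q) = 0 := by
  intro q hq
  by_cases hα : i = χ.α
  · rw [hα, form_α]
    exact χ.curve_α q hq
  by_cases hβ : i = χ.β
  · rw [hβ, form_β]
    exact χ.curve_β q hq
  rw [χ.form_of_mem_others (χ.mem_others.2 ⟨hi, hα, hβ⟩)]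
  exact χ.curve_line i hi q hq

theorem form_ne_zero (hi : p ∈ D.curve i) : χ.form i ≠ 0 :=
  linear_ne_zero_of_isSmoothClosedCurve (D.isCurve i) (χ.mem_curve_iff_form hi) χ.mem_source hi

theorem exists_form_eq_zero_form_ne_zero (hi : p ∈ D.curve i) (hj : p ∈ D.curve j) (hij : i ≠ j) :
    ∃ v, χ.form i v = 0 ∧ χ.form j v ≠ 0 :=
  exists_eq_zero_ne_zero_of_transverse χ.mem_atlas (χ.form_ne_zero hi) (χ.form_ne_zero hj)
    (χ.mem_curve_iff_form hi) (χ.mem_curve_iff_form hj) χ.mem_source hi hj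
    (D.transverse i j hij p hi hj)

theorem A_ne_zero (hi : i ∈ χ.others) : χ.A i ≠ 0 := by
  obtain ⟨hpi, -, hiβ⟩ := χ.mem_others.1 hi
  obtain ⟨v, hv, hiv⟩ := χ.exists_form_eq_zero_form_ne_zero χ.β_mem hpi hiβ.symm
  rw [form_β] at hv
  rw [χ.form_of_mem_others hi, hv, mul_zero, add_zero] at hiv
  exact left_ne_zero_of_mul hiv

theorem B_ne_zero (hi : i ∈ χ.others) : χ.B i ≠ 0 := by
  obtain ⟨hpi, hiα, -⟩ := χ.mem_others.1 hi
  obtain ⟨v, hv, hiv⟩ := χ.exists_form_eq_zero_form_ne_zero χ.α_mem hpi hiα.symm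
  rw [form_α] at hv
  rw [χ.form_of_mem_others hi, hv, mul_zero, zero_add] at hiv
  exact left_ne_zero_of_mul hiv

theorem A_mul_B_ne (hi : i ∈ χ.others) (hj : j ∈ χ.others) (hij : i ≠ j) :
    χ.A i * χ.B j ≠ χ.A j * χ.B i := by
  intro hAB
  obtain ⟨v, hv, hjv⟩ :=
    χ.exists_form_eq_zero_form_ne_zero (χ.mem_others.1 hi).1 (χ.mem_others.1 hj).1 hij
  rw [χ.form_of_mem_others hi] at hv
  rw [χ.form_of_mem_others hj] at hjv
  refine mul_ne_zero (χ.A_ne_zero hi) hjv ?_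
  linear_combination χ.A j * hv + v 1 * hAB

/-- The part of the chart domain that misses the curves not passing through `p`. -/
def domain (χ : StarChart D p) : Set S :=
  χ.chart.source ∩ {q | ∀ i, q ∈ D.curve i → p ∈ D.curve i}

theorem isOpen_domain : IsOpen χ.domain := by
  refine χ.chart.open_source.inter ?_
  simp only [Set.ofPred_forall]
  refine isOpen_iInter_of_finite fun i => ?_
  by_cases hi : p ∈ D.curve i
  · simp [hi]
  · simp only [hi, imp_false]
    exact (D.isCurve i).1.isOpen_compl

theorem domain_mem_nhds : χ.domain ∈ 𝓝 p :=
  χ.isOpen_domain.mem_nhds ⟨χ.mem_source, fun _ h => h⟩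

theorem mem_support_iff {q : S} (hq : q ∈ χ.domain) :
    q ∈ D.support ↔ χ.formProd (χ.chart q) = 0 := by
  rw [formProd, Finset.prod_eq_zero_iff, StarDivisor.support, Set.mem_iUnion]
  constructor
  · rintro ⟨i, hi⟩
    exact ⟨i, χ.mem_through.2 (hq.2 i hi), (χ.mem_curve_iff_form (hq.2 i hi) q hq.1).1 hi⟩
  · rintro ⟨i, hi, h⟩
    exact ⟨i, (χ.mem_curve_iff_form (χ.mem_through.1 hi) q hq.1).2 h⟩

theorem symm_zero : χ.chart.symm 0 = p := by
  rw [← χ.centered, χ.chart.left_inv χ.mem_source]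

theorem zero_mem_target : (0 : Plane) ∈ χ.chart.target :=
  χ.centered ▸ χ.chart.map_source χ.mem_source

theorem tendsto_chart : Tendsto χ.chart (𝓝 p) (𝓝 0) := by
  simpa only [χ.centered] using (χ.chart.continuousAt χ.mem_source).tendsto

theorem tendsto_symm : Tendsto χ.chart.symm (𝓝 0) (𝓝 p) := by
  simpa only [χ.symm_zero] using (χ.chart.continuousAt_symm χ.zero_mem_target).tendsto

theorem neBot_nhdsWithin_compl_support (χ : StarChart D p) : (𝓝[D.supportᶜ] p).NeBot := by
  obtain ⟨v, -, hv⟩ := exists_eventually_prod_ne_zero (L := χ.form) (s := χ.through) (p := ⊤)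
    fun i hi => by simpa using DFunLike.ne_iff.1 (χ.form_ne_zero (χ.mem_through.1 hi))
  have hray : Tendsto (fun t : ℝ => 0 + t • v) (𝓝[≠] 0) (𝓝 0) := by
    have hcont : Continuous fun t : ℝ => 0 + t • v := by fun_prop
    simpa using (hcont.tendsto 0).mono_left nhdsWithin_le_nhds
  have hlim := χ.tendsto_symm.comp hray
  refine (tendsto_nhdsWithin_iff.2 ⟨hlim, ?_⟩).neBot
  filter_upwards [hv 0, hlim χ.domain_mem_nhds,
    hray (χ.chart.open_target.mem_nhds χ.zero_mem_target)] with t ht hdom htarget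
  rw [Set.mem_compl_iff, χ.mem_support_iff hdom, Function.comp_apply, χ.chart.right_inv htarget]
  exact ht

theorem dxdy_eq {q : S} (hq : q ∈ χ.chart.source) :
    χ.dxdy q = areaForm.compContinuousLinearMap (chartDeriv χ.chart q) := by
  have hcoord : ∀ k : Fin 2, mfderiv (𝓡 2) 𝓘(ℝ, ℝ) (fun q => χ.chart q k) q =
      (EuclideanSpace.proj k).comp (chartDeriv χ.chart q) := fun k =>
    (hasMFDerivAt_comp_chart χ.mem_atlas hq (EuclideanSpace.proj (𝕜 := ℝ) k)).mfderiv
  exact congrArg₂ wedge (hcoord 0) (hcoord 1)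

theorem dxdy_apply {q : S} (hq : q ∈ χ.chart.source) (v w : TangentSpace (𝓡 2) q) :
    χ.dxdy q ![v, w] = areaForm ![chartDeriv χ.chart q v, chartDeriv χ.chart q w] := by
  rw [χ.dxdy_eq hq, ContinuousAlternatingMap.compContinuousLinearMap_apply]
  congr 1
  ext i : 1
  fin_cases i <;> rfl

end StarChart

namespace StarChart

variable {S : Type*} [TopologicalSpace S] [ChartedSpace Plane S]
  {n : ℕ} {D : StarDivisor S n} {p : S} (χ : StarChart D p)

/-- `Ω = (F / (x y ∏ L_i)) dx ∧ dy` at the point `q`, unless `q` lies on the divisor, where the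
values of `Ω` are ignored. -/
def HasCoefficientAt (Ω : TwoForm S) (F : Plane → ℝ) (q : S) : Prop :=
  q ∉ D.support → Ω q = (F (χ.chart q) / χ.formProd (χ.chart q)) • χ.dxdy q

/-- The function `F` of the coordinates is the coefficient of the `b`-form `Ω` near `p`. -/
def HasCoefficient (Ω : TwoForm S) (F : Plane → ℝ) : Prop :=
  ∀ᶠ q in 𝓝 p, χ.HasCoefficientAt Ω F q

/-- The coordinate expression of the `b`-field `y ∏ L_i ∂_y`, which together with the Euler field
`x ∂_x + y ∂_y` spans the `b`-tangent bundle off the divisor. -/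
noncomputable def verticalField (z : Plane) : Plane :=
  (∏ i ∈ insert χ.β χ.others, χ.form i z) • EuclideanSpace.single 1 1

theorem contDiff_verticalField : ContDiff ℝ ∞ χ.verticalField :=
  (contDiff_prod fun i _ => (χ.form i).contDiff).smul contDiff_const

theorem areaForm_verticalField (z : Plane) : areaForm ![z, χ.verticalField z] = χ.formProd z := by
  rw [formProd, through, Finset.prod_insert χ.α_notMem_insert, form_α]
  simp [areaForm_apply, verticalField]

theorem form_verticalField {i : Fin n} (hi : i ∈ χ.through) {z : Plane} (hz : χ.form i z = 0) :
    χ.form i (χ.verticalField z) = 0 := by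
  rw [verticalField, map_smul, smul_eq_mul]
  rcases Finset.mem_insert.1 hi with rfl | hi
  · simp [form_α]
  · rw [Finset.prod_eq_zero hi hz, zero_mul]

theorem exists_eventually_eq_formProd_mul {f : Plane → ℝ} {O : Set Plane} (hO : IsOpen O)
    (h0 : (0 : Plane) ∈ O) (hf : ContDiffOn ℝ ∞ f O)
    (hvanish : ∀ i, p ∈ D.curve i → ∀ z ∈ O, χ.form i z = 0 → f z = 0) :
    ∃ d : Plane → ℝ, ContDiff ℝ ∞ d ∧ ∀ᶠ z in 𝓝 0, f z = χ.formProd z * d z := by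
  obtain ⟨g, hg, hgf, hsupp⟩ := exists_contDiff_eventuallyEq hO h0 hf
  obtain ⟨d, hd, hgd⟩ := exists_contDiff_eq_prod_mul (L := χ.form) (s := χ.through) hg
    (fun i hi => χ.form_ne_zero (χ.mem_through.1 hi))
    (fun i hi j hj => χ.exists_form_eq_zero_form_ne_zero (χ.mem_through.1 hi)
      (χ.mem_through.1 hj))
    (fun i hi z hz => by
      by_contra hgz
      obtain ⟨hzO, hfz⟩ := hsupp hgz
      exact hfz (hvanish i (χ.mem_through.1 hi) z hzO hz))
  refine ⟨d, hd, ?_⟩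
  filter_upwards [hgf] with z hz
  rw [← hz, hgd, formProd]

variable [IsManifold (𝓡 2) ∞ S]

theorem isBVectorFieldOn_chartField {V : Plane → Plane} (hV : ContDiff ℝ ∞ V)
    (ht : ∀ i ∈ χ.through, ∀ z, χ.form i z = 0 → χ.form i (V z) = 0) :
    IsBVectorFieldOn D χ.domain (chartField χ.chart V) where
  contMDiffOn := (contMDiffOn_chartField χ.mem_atlas hV).mono Set.inter_subset_left
  tangent := by
    intro q hq i hi
    have hpi := hq.2 i hi
    have hc := χ.mem_curve_iff_form hpi
    rw [mem_tangentLine_iff χ.mem_atlas (χ.form_ne_zero hpi) hc hq.1 hi,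
      chartDeriv_chartField χ.mem_atlas hq.1]
    exact ht i (χ.mem_through.2 hpi) _ ((hc q hq.1).1 hi)

theorem exists_hasCoefficient {Ω : TwoForm S} (hΩ : IsBTwoForm D Ω) :
    ∃ F : Plane → ℝ, ContDiff ℝ ∞ F ∧ χ.HasCoefficient Ω F := by
  obtain ⟨g, hg, hgΩ⟩ := hΩ χ.domain χ.isOpen_domain _ _
    (χ.isBVectorFieldOn_chartField contDiff_id fun _ _ _ hz => hz)
    (χ.isBVectorFieldOn_chartField χ.contDiff_verticalField fun _ hi _ => χ.form_verticalField hi)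
  have hgs : ContDiffOn ℝ ∞ (fun z => g (χ.chart.symm z))
      (χ.chart.target ∩ χ.chart.symm ⁻¹' χ.domain) :=
    contMDiffOn_iff_contDiffOn.1 (hg.comp
      ((contMDiffOn_symm_of_mem_maximalAtlas χ.mem_atlas).mono Set.inter_subset_left)
      fun z hz => hz.2)
  obtain ⟨F, hF, hFg, -⟩ := exists_contDiff_eventuallyEq
    (χ.chart.isOpen_inter_preimage_symm χ.isOpen_domain)
    ⟨χ.zero_mem_target, mem_of_mem_nhds (χ.tendsto_symm χ.domain_mem_nhds)⟩ hgs
  refine ⟨F, hF, ?_⟩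
  filter_upwards [χ.domain_mem_nhds, χ.tendsto_chart hFg] with q hq hqF hqD
  have hFq : F (χ.chart q) = g q := by simpa [χ.chart.left_inv hq.1] using hqF
  have hprod : χ.formProd (χ.chart q) ≠ 0 := mt (χ.mem_support_iff hq).2 hqD
  obtain ⟨κ, hκ⟩ := exists_eq_smul_areaForm_comp_chartDeriv χ.mem_atlas hq.1 (Ω q)
  rw [← χ.dxdy_eq hq.1] at hκ
  have hgκ : κ * χ.formProd (χ.chart q) = g q := by
    rw [← hgΩ q hq hqD, hκ, ContinuousAlternatingMap.smul_apply, χ.dxdy_apply hq.1,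
      chartDeriv_chartField χ.mem_atlas hq.1, chartDeriv_chartField χ.mem_atlas hq.1, id,
      areaForm_verticalField, smul_eq_mul]
  rw [hκ, hFq, ← hgκ, mul_div_cancel_right₀ _ hprod]

theorem exists_areaForm_chartDeriv_eq {U : Set S} (hU : IsOpen U) (hpU : p ∈ U)
    {X Y : ∀ q : S, TangentSpace (𝓡 2) q} (hX : IsBVectorFieldOn D U X)
    (hY : IsBVectorFieldOn D U Y) :
    ∃ d : Plane → ℝ, ContDiff ℝ ∞ d ∧ ∀ᶠ q in 𝓝 p,
      areaForm ![chartDeriv χ.chart q (X q), chartDeriv χ.chart q (Y q)] =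
        χ.formProd (χ.chart q) * d (χ.chart q) := by
  have hVX := contDiffOn_chartDeriv χ.mem_atlas hU hX.contMDiffOn
  have hVY := contDiffOn_chartDeriv χ.mem_atlas hU hY.contMDiffOn
  have harea : ContDiffOn ℝ ∞ (fun z =>
      areaForm ![chartDeriv χ.chart (χ.chart.symm z) (X (χ.chart.symm z)),
        chartDeriv χ.chart (χ.chart.symm z) (Y (χ.chart.symm z))])
      (χ.chart.target ∩ χ.chart.symm ⁻¹' U) := by
    refine areaForm.toContinuousMultilinearMap.contDiff.comp_contDiffOn
      (contDiffOn_pi.2 fun i => ?_)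
    fin_cases i
    exacts [hVX, hVY]
  have hpU' : U ∈ 𝓝 p := hU.mem_nhds hpU
  obtain ⟨d, hd, hfd⟩ := χ.exists_eventually_eq_formProd_mul
    (χ.chart.isOpen_inter_preimage_symm hU)
    ⟨χ.zero_mem_target, mem_of_mem_nhds (χ.tendsto_symm hpU')⟩ harea (by
      intro i hi z ⟨hzt, hzU⟩ hz
      have hc := χ.mem_curve_iff_form hi
      have hq := χ.chart.map_target hzt
      have hqc : χ.chart.symm z ∈ D.curve i := (hc _ hq).2 (by rwa [χ.chart.right_inv hzt])
      have htangent := mem_tangentLine_iff χ.mem_atlas (χ.form_ne_zero hi) hc hq hqc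
      exact areaForm_eq_zero_of_ker (χ.form_ne_zero hi) ((htangent _).1 (hX.tangent _ hzU i hqc))
        ((htangent _).1 (hY.tangent _ hzU i hqc)))
  refine ⟨d, hd, ?_⟩
  filter_upwards [χ.tendsto_chart.eventually hfd, χ.domain_mem_nhds] with q hq hdom
  rwa [χ.chart.left_inv hdom.1] at hq

theorem HasCoefficient.ne_zero {χ : StarChart D p} {Ω : TwoForm S} {F : Plane → ℝ}
    (hΩF : χ.HasCoefficient Ω F) (hF : Continuous F) (hΩ : IsStarLogSymplectic D Ω) :
    F 0 ≠ 0 := by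
  obtain ⟨U, X, Y, g, hU, hpU, hX, hY, ⟨hg, hgΩ⟩, hgp⟩ := hΩ.nondegenerate p
  obtain ⟨d, hd, hXY⟩ := χ.exists_areaForm_chartDeriv_eq hU hpU hX hY
  have := χ.neBot_nhdsWithin_compl_support
  have hgFd : g p = F 0 * d 0 := by
    have hg0 : Tendsto g (𝓝[D.supportᶜ] p) (𝓝 (g p)) :=
      (hg.continuousOn.continuousAt (hU.mem_nhds hpU)).tendsto.mono_left nhdsWithin_le_nhds
    have hFd : Tendsto (fun q => F (χ.chart q) * d (χ.chart q)) (𝓝[D.supportᶜ] p)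
        (𝓝 (F 0 * d 0)) :=
      (((hF.mul hd.continuous).tendsto 0).comp χ.tendsto_chart).mono_left nhdsWithin_le_nhds
    refine tendsto_nhds_unique_of_eventuallyEq hg0 hFd ?_
    filter_upwards [nhdsWithin_le_nhds hΩF, nhdsWithin_le_nhds hXY,
      nhdsWithin_le_nhds χ.domain_mem_nhds, nhdsWithin_le_nhds (hU.mem_nhds hpU),
      self_mem_nhdsWithin] with q hΩq hXYq hdom hqU hqD
    have hprod : χ.formProd (χ.chart q) ≠ 0 := mt (χ.mem_support_iff hdom).2 hqD
    rw [← hgΩ q hqU hqD, hΩq hqD, ContinuousAlternatingMap.smul_apply, χ.dxdy_apply hdom.1, hXYq,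
      smul_eq_mul]
    field_simp
  exact left_ne_zero_of_mul (hgFd ▸ hgp)

end StarChart

theorem exists_pow_normalization {a : ℝ} (ha : a ≠ 0) (m : ℕ) :
    ∃ r : ℝ, r ≠ 0 ∧ (m ≠ 0 → a / r ^ m = 1 ∨ a / r ^ m = -1) ∧ (Odd m → a / r ^ m = 1) := by
  rcases eq_or_ne m 0 with rfl | hm
  · exact ⟨1, one_ne_zero, by simp, by simp⟩
  have hroot : (|a| ^ (m⁻¹ : ℝ)) ^ m = |a| := Real.rpow_inv_natCast_pow (abs_nonneg a) hm
  have hroot0 : |a| ^ (m⁻¹ : ℝ) ≠ 0 := (Real.rpow_pos_of_pos (abs_pos.2 ha) _).ne'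
  by_cases hsign : |a| = a
  · have hdiv : a / (|a| ^ (m⁻¹ : ℝ)) ^ m = 1 := by rw [hroot, hsign, div_self ha]
    exact ⟨_, hroot0, fun _ => .inl hdiv, fun _ => hdiv⟩
  have habs : |a| = -a := (abs_choice a).resolve_left hsign
  by_cases hodd : Odd m
  · have hdiv : a / (-(|a| ^ (m⁻¹ : ℝ))) ^ m = 1 := by
      rw [hodd.neg_pow, hroot, habs, neg_neg, div_self ha]
    exact ⟨_, neg_ne_zero.2 hroot0, fun _ => .inl hdiv, fun _ => hdiv⟩
  · refine ⟨_, hroot0, fun _ => .inr ?_, fun h => absurd h hodd⟩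
    rw [hroot, habs, div_neg, div_self ha]

section SMulSelf

variable {E : Type*} [NormedAddCommGroup E] [NormedSpace ℝ E] {ρ : E → ℝ}

theorem hasFDerivAt_smul_self {z : E} (hρ : DifferentiableAt ℝ ρ z) :
    HasFDerivAt (fun z => ρ z • z)
      (ρ z • ContinuousLinearMap.id ℝ E + (fderiv ℝ ρ z).smulRight z) z :=
  hρ.hasFDerivAt.smul (hasFDerivAt_id z)

theorem exists_openPartialHomeomorph_smul_self [CompleteSpace E]
    (hρ : ∀ᶠ z in 𝓝 0, ContDiffAt ℝ ∞ ρ z) (hρ0 : ρ 0 ≠ 0) {O : Set E} (hO : O ∈ 𝓝 0) :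
    ∃ ψ : OpenPartialHomeomorph E E, 0 ∈ ψ.source ∧ ψ.source ⊆ O ∧ ψ.target ⊆ O ∧
      (∀ z, ψ z = ρ z • z) ∧ ContDiffOn ℝ ∞ ψ.symm ψ.target ∧
      ∀ z ∈ ψ.source, ContDiffAt ℝ ∞ ρ z ∧ ρ z ≠ 0 := by
  have hρ' : ContDiffAt ℝ ∞ ρ 0 := hρ.self_of_nhds
  have hderiv : HasFDerivAt (fun z => ρ z • z)
      (ContinuousLinearEquiv.smulLeft (R₁ := ℝ) (M₁ := E) (Units.mk0 (ρ 0) hρ0) : E →L[ℝ] E) 0 := by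
    refine (hasFDerivAt_smul_self (hρ'.differentiableAt (by simp))).congr_fderiv ?_
    ext v
    simp [Units.smul_def]
  have hradial : Tendsto (fun z => ρ z • z) (𝓝 0) (𝓝 0) := by
    simpa only [ContinuousAt, smul_zero] using hderiv.continuousAt
  obtain ⟨ψ, h0ψ, hψO, hψ, hψsymm⟩ := exists_openPartialHomeomorph_of_eventually_contDiffAt
    (f := fun z => ρ z • z) (hρ.mono fun z hz => hz.smul contDiffAt_id) hderiv
    (inter_mem hO ((hradial.eventually_mem hO).and (hρ.and (hρ'.continuousAt.eventually_ne hρ0))))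
  refine ⟨ψ, h0ψ, fun z hz => (hψO hz).1, fun w hw => ?_, hψ, hψsymm, fun z hz => (hψO hz).2.2⟩
  have hwO : ρ (ψ.symm w) • ψ.symm w ∈ O := (hψO (ψ.map_target hw)).2.1
  rwa [← hψ, ψ.right_inv hw] at hwO

end SMulSelf

namespace StarChart

variable {S : Type*} [TopologicalSpace S] [ChartedSpace Plane S]
  {n : ℕ} {D : StarDivisor S n} {p : S} (χ : StarChart D p)

theorem exists_hasCoefficient_normalForm {h : MvPolynomial (Fin 2) ℝ}
    (hh : h.IsHomogeneous χ.others.card) (hh0 : h.coeff 0 = 0) :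
    ∃ lam del : Fin n → ℝ, ∀ c, χ.HasCoefficient (χ.normalForm c lam del 0)
      fun z => c + MvPolynomial.eval z.ofLp h := by
  obtain ⟨lam, del, hP⟩ := exists_normalForm_coefficients hh hh0 (fun i => χ.A_ne_zero)
    (fun i => χ.B_ne_zero) fun i hi j hj => χ.A_mul_B_ne hi hj
  refine ⟨lam, del, fun c => ?_⟩
  filter_upwards [χ.domain_mem_nhds] with q hq hqD
  have hprod : χ.formProd (χ.chart q) ≠ 0 := mt (χ.mem_support_iff hq).2 hqD
  rw [formProd_eq] at hprod ⊢
  obtain ⟨⟨hx, hy⟩, hlines⟩ := mul_ne_zero_iff.1 hprod |>.imp_left mul_ne_zero_iff.1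
  have hpole := hP _ _ hx hy (Finset.prod_ne_zero_iff.1 hlines)
  have hvec : ![χ.chart q 0, χ.chart q 1] = (χ.chart q).ofLp := by
    ext i
    fin_cases i <;> rfl
  rw [hvec] at hpole
  simp only [normalForm, polePart, line, x, y, Pi.zero_apply, zero_div, Finset.sum_const_zero,
    add_zero, add_div, hpole]

/-- In the star chart, `Ψ` is the radial map `z ↦ ρ z • z`. It preserves the lines through the
origin, hence every curve of the divisor. -/
structure IsRadial (ρ : Plane → ℝ) (Ψ : OpenPartialHomeomorph S S) : Prop where
  source_subset : Ψ.source ⊆ χ.domain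
  target_subset : Ψ.target ⊆ χ.domain
  chart_apply : ∀ q ∈ Ψ.source, χ.chart (Ψ q) = ρ (χ.chart q) • χ.chart q
  contDiffAt : ∀ q ∈ Ψ.source, ContDiffAt ℝ ∞ ρ (χ.chart q)
  ne_zero : ∀ q ∈ Ψ.source, ρ (χ.chart q) ≠ 0
  contMDiffOn_symm : ContMDiffOn (𝓡 2) (𝓡 2) ∞ Ψ.symm Ψ.target

theorem exists_isRadial {ρ : Plane → ℝ} (hρ : ∀ᶠ z in 𝓝 0, ContDiffAt ℝ ∞ ρ z) (hρ0 : ρ 0 ≠ 0)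
    {V : Set S} (hV : V ∈ 𝓝 p) :
    ∃ Ψ : OpenPartialHomeomorph S S, p ∈ Ψ.source ∧ Ψ p = p ∧ Ψ.source ⊆ V ∧ Ψ.target ⊆ V ∧
      χ.IsRadial ρ Ψ := by
  obtain ⟨ψ, h0ψ, hψsource, hψtarget, hψ, hψsymm, hψρ⟩ := exists_openPartialHomeomorph_smul_self
    hρ hρ0 ((χ.chart.open_target.eventually_mem χ.zero_mem_target).and
      (χ.tendsto_symm (inter_mem hV χ.domain_mem_nhds)))
  let Ψ := (χ.chart.trans ψ).trans χ.chart.symm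
  have hΨ : ∀ q ∈ Ψ.source, q ∈ χ.chart.source ∧ χ.chart q ∈ ψ.source := by
    intro q hq
    simp only [Ψ, mfld_simps] at hq
    exact hq.1
  have hΨsymm : ∀ q ∈ Ψ.target, q ∈ χ.chart.source ∧ χ.chart q ∈ ψ.target := by
    intro q hq
    simp only [Ψ, mfld_simps] at hq
    exact ⟨hq.1, hq.2.1⟩
  have hsource : Ψ.source ⊆ V ∩ χ.domain := fun q hq => by
    simpa only [χ.chart.left_inv (hΨ q hq).1] using (hψsource (hΨ q hq).2).2
  have htarget : Ψ.target ⊆ V ∩ χ.domain := fun q hq => by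
    simpa only [χ.chart.left_inv (hΨsymm q hq).1] using (hψtarget (hΨsymm q hq).2).2
  have hpΨ : p ∈ Ψ.source := by
    simp [Ψ, χ.mem_source, χ.centered, h0ψ, hψ, χ.zero_mem_target]
  refine ⟨Ψ, hpΨ, by simp [Ψ, χ.centered, hψ, χ.symm_zero],
    hsource.trans Set.inter_subset_left, htarget.trans Set.inter_subset_left,
    { source_subset := hsource.trans Set.inter_subset_right
      target_subset := htarget.trans Set.inter_subset_right
      chart_apply := fun q hq => ?_
      contDiffAt := fun q hq => (hψρ _ (hΨ q hq).2).1
      ne_zero := fun q hq => (hψρ _ (hΨ q hq).2).2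
      contMDiffOn_symm := ?_ }⟩
  · rw [← hψ]
    exact χ.chart.right_inv (hψtarget (ψ.map_source (hΨ q hq).2)).1
  · have hsymm := contMDiffOn_symm_of_mem_maximalAtlas χ.mem_atlas
    exact hsymm.comp ((contMDiffOn_iff_contDiffOn.2 hψsymm).comp
      ((contMDiffOn_of_mem_maximalAtlas χ.mem_atlas).mono fun q hq => (hΨsymm q hq).1)
      fun q hq => (hΨsymm q hq).2) fun q hq => (hψsource (ψ.map_target (hΨsymm q hq).2)).1

namespace IsRadial

variable {χ} {ρ : Plane → ℝ} {Ψ : OpenPartialHomeomorph S S} (hΨ : χ.IsRadial ρ Ψ) {q : S}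
include hΨ

theorem mem_curve_iff (i : Fin n) (hq : q ∈ Ψ.source) : Ψ q ∈ D.curve i ↔ q ∈ D.curve i := by
  have hdom := hΨ.source_subset hq
  have hdom' := hΨ.target_subset (Ψ.map_source hq)
  by_cases hi : p ∈ D.curve i
  · rw [χ.mem_curve_iff_form hi _ hdom'.1, χ.mem_curve_iff_form hi _ hdom.1, hΨ.chart_apply q hq,
      map_smul, smul_eq_zero, or_iff_right (hΨ.ne_zero q hq)]
  · exact iff_of_false (mt (hdom'.2 i) hi) (mt (hdom.2 i) hi)

theorem notMem_support (hq : q ∈ Ψ.source) (hqD : q ∉ D.support) : Ψ q ∉ D.support := by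
  simpa only [StarDivisor.support, Set.mem_iUnion, hΨ.mem_curve_iff _ hq] using hqD

theorem contMDiffOn : ContMDiffOn (𝓡 2) (𝓡 2) ∞ Ψ Ψ.source := by
  have hchart : ContMDiffOn (𝓡 2) (𝓡 2) ∞ (fun q => ρ (χ.chart q) • χ.chart q) Ψ.source :=
    fun q hq => ((((hΨ.contDiffAt q hq).smul contDiffAt_id).contMDiffAt.comp q
      (contMDiffAt_of_mem_maximalAtlas χ.mem_atlas (hΨ.source_subset hq).1))).contMDiffWithinAt
  refine ((contMDiffOn_symm_of_mem_maximalAtlas χ.mem_atlas).comp hchart fun q hq => ?_).congr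
    fun q hq => ?_
  · rw [Set.mem_preimage, ← hΨ.chart_apply q hq]
    exact χ.chart.map_source (hΨ.target_subset (Ψ.map_source hq)).1
  · rw [Function.comp_apply, ← hΨ.chart_apply q hq,
      χ.chart.left_inv (hΨ.target_subset (Ψ.map_source hq)).1]

theorem chartDeriv_comp_mfderiv (hq : q ∈ Ψ.source) :
    (chartDeriv χ.chart (Ψ q)).comp (mfderiv (𝓡 2) (𝓡 2) Ψ q) =
      (ρ (χ.chart q) • ContinuousLinearMap.id ℝ Plane +
        (fderiv ℝ ρ (χ.chart q)).smulRight (χ.chart q)).comp (chartDeriv χ.chart q) := by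
  have hleft : HasMFDerivAt (𝓡 2) (𝓡 2) (χ.chart ∘ Ψ) q
      ((chartDeriv χ.chart (Ψ q)).comp (mfderiv (𝓡 2) (𝓡 2) Ψ q)) :=
    (hasMFDerivAt_chart χ.mem_atlas (hΨ.target_subset (Ψ.map_source hq)).1).comp q
      ((hΨ.contMDiffOn.contMDiffAt (Ψ.open_source.mem_nhds hq)).mdifferentiableAt
        (by simp)).hasMFDerivAt
  have hright := HasMFDerivAt.comp q
    (hasFDerivAt_smul_self ((hΨ.contDiffAt q hq).differentiableAt (by simp))).hasMFDerivAt
    (hasMFDerivAt_chart χ.mem_atlas (hΨ.source_subset hq).1)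
  exact hasMFDerivAt_unique hleft (hright.congr_of_eventuallyEq
    (Filter.eventually_of_mem (Ψ.open_source.mem_nhds hq) hΨ.chart_apply))

theorem pullback_dxdy (hq : q ∈ Ψ.source) :
    (χ.dxdy (Ψ q)).compContinuousLinearMap (mfderiv (𝓡 2) (𝓡 2) Ψ q) =
      (ρ (χ.chart q) * (ρ (χ.chart q) + fderiv ℝ ρ (χ.chart q) (χ.chart q))) • χ.dxdy q := by
  rw [χ.dxdy_eq (hΨ.source_subset hq).1, χ.dxdy_eq (hΨ.target_subset (Ψ.map_source hq)).1]
  exact (congrArg areaForm.compContinuousLinearMap (hΨ.chartDeriv_comp_mfderiv hq)).trans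
    (congrArg (fun η => η.compContinuousLinearMap (chartDeriv χ.chart q))
      (areaForm_comp_radial _ _ _))

theorem isBSymplectomorphism {Ω₀ Ω : TwoForm S} {F G : Plane → ℝ}
    (hF : ∀ q ∈ Ψ.target, χ.HasCoefficientAt Ω F q)
    (hG : ∀ q ∈ Ψ.source, χ.HasCoefficientAt Ω₀ G q)
    (hFG : ∀ q ∈ Ψ.source,
      (ρ (χ.chart q) + fderiv ℝ ρ (χ.chart q) (χ.chart q)) * F (ρ (χ.chart q) • χ.chart q) =
        G (χ.chart q) * ρ (χ.chart q) ^ (χ.others.card + 1)) :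
    IsBSymplectomorphism D Ω₀ Ω Ψ where
  contMDiffOn := hΨ.contMDiffOn
  contMDiffOn_symm := hΨ.contMDiffOn_symm
  mem_curve_iff i q hq := hΨ.mem_curve_iff i hq
  pullback_eq := by
    intro q hq hqD
    have hρ := hΨ.ne_zero q hq
    have hprod : χ.formProd (χ.chart q) ≠ 0 :=
      mt (χ.mem_support_iff (hΨ.source_subset hq)).2 hqD
    rw [hF _ (Ψ.map_source hq) (hΨ.notMem_support hq hqD), hG q hq hqD]
    have hsmul : ∀ a : ℝ, (a • χ.dxdy (Ψ q)).compContinuousLinearMap (mfderiv (𝓡 2) (𝓡 2) Ψ q) =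
      a • (χ.dxdy (Ψ q)).compContinuousLinearMap (mfderiv (𝓡 2) (𝓡 2) Ψ q) := fun _ => rfl
    rw [hsmul, hΨ.pullback_dxdy hq, smul_smul, hΨ.chart_apply q hq, formProd_smul]
    congr 1
    field_simp
    linear_combination ρ (χ.chart q) * hFG q hq

end IsRadial

end StarChart

end StarLog

theorem proposition3p2 {S : Type*} [TopologicalSpace S] [ChartedSpace StarLog.Plane S]
    [IsManifold (𝓡 2) ∞ S] {n : ℕ} (D : StarLog.StarDivisor S n)
    (Ω : StarLog.TwoForm S) (hΩ : StarLog.IsStarLogSymplectic D Ω)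
    (p : S) (k : ℕ) (hk : D.degree p = k) (χ : StarLog.StarChart D p) :
    ∃ (c : ℝ) (lam del : Fin n → ℝ) (nu : Fin n → Fin n → ℝ) (Ψ : OpenPartialHomeomorph S S),
      c ≠ 0 ∧ (3 ≤ k → c = 1 ∨ c = -1) ∧ (3 ≤ k → Odd k → c = 1) ∧
      p ∈ Ψ.source ∧ Ψ.source ⊆ χ.chart.source ∧ Ψ p = p ∧
      StarLog.IsBSymplectomorphism D (χ.normalForm c lam del nu) Ω Ψ := by
  obtain ⟨F, hF, hΩF⟩ := χ.exists_hasCoefficient hΩ.isBTwoForm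
  have hF0 := hΩF.ne_zero hF.continuous hΩ
  obtain ⟨r, hr, hsign, hodd⟩ := StarLog.exists_pow_normalization hF0 χ.others.card
  obtain ⟨h, ρ, hh, hh0, rfl, hρ⟩ := StarLog.exists_radial_scaling hF hF0 χ.others.card hr
  obtain ⟨lam, del, hP⟩ := χ.exists_hasCoefficient_normalForm hh hh0
  have hnear := hΩF.and ((hP (F 0 / ρ 0 ^ χ.others.card)).and (χ.tendsto_chart.eventually hρ))
  obtain ⟨Ψ, hpΨ, hΨp, hsource, htarget, hΨ⟩ :=
    χ.exists_isRadial (hρ.mono fun _ hz => hz.1) hr hnear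
  have hdegree := χ.degree_eq
  exact ⟨_, lam, del, 0, Ψ, div_ne_zero hF0 (pow_ne_zero _ hr), fun hk3 => hsign (by omega),
    fun _ hkodd => hodd (by grind), hpΨ, fun q hq => (hΨ.source_subset hq).1, hΨp,
    hΨ.isBSymplectomorphism (fun q hq => (htarget hq).1) (fun q hq => (hsource hq).2.1)
      fun q hq => (hsource hq).2.2.2.2⟩
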